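/- Let $(\Omega,\mathcal F,(\mathcal F_t)_{t\ge 0},\mathbb P)$ be a filtered probability space satisfying the usual conditions, and let $B^1,B^2$ be two independent one-dimensional Brownian motions, each of them a Brownian motion with respect to $(\mathcal F_t)_{t\ge 0}$. Let $T\ge 0$ and let $f,g\colon\Omega\times[0,T]\to\mathbb R$ be jointly measurable, adapted, and such that $$\mathbb E\Big(\int_0^T |f_u|^2+|g_u|^2\,\mathrm du\Big)<\infty .$$ Let $\mathcal G$ be a sub-$\sigma$-algebra of $\mathcal F$ such that, for $i=1,2$ and all $0\le u\le v\le T$, the increment $B^i_v-B^i_u$ is independent of $\sigma(\mathcal F_u,\mathcal G)$. Let $0\le s\le t\le T$, let $h_1$ be a bounded $\mathcal G$-measurable real function and $h_2$ a bounded $\mathcal F_s$-measurable real function. Then $$\mathbb E\Big(h_1h_2\int_0^t f_u\,\mathrm dB^1_u\int_0^t g_u\,\mathrm dB^2_u\Big)=\mathbb E\Big(h_1h_2\int_0^s f_u\,\mathrm dB^1_u\int_0^s g_u\,\mathrm dB^2_u\Big),$$ where the stochastic integrals are Itô integrals and both random variables inside the expectations are integrable. -/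

import Mathlib

open MeasureTheory ProbabilityTheory Filter Topology
open scoped NNReal ENNReal

/-- The usual conditions: the filtration is right-continuous, and `𝓕 0` (hence every `𝓕 t`, and
the ambient σ-algebra) contains every set of outer measure zero. -/
structure UsualConditions {Ω : Type*} {mΩ : MeasurableSpace Ω} (𝓕 : Filtration ℝ≥0 mΩ)
    (μ : Measure Ω) : Prop where
  rightContinuous : 𝓕.IsRightContinuous
  complete : ∀ A : Set Ω, μ A = 0 → MeasurableSet[𝓕 0] A

/-- `B` is a real Brownian motion (started at `0`, almost surely continuous) with respect to the
filtration `𝓕`: it is adapted, and the increments after time `u` are independent of `𝓕 u`. -/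
structure IsFilteredBrownian {Ω : Type*} {mΩ : MeasurableSpace Ω} (𝓕 : Filtration ℝ≥0 mΩ)
    (μ : Measure Ω) (B : ℝ≥0 → Ω → ℝ) : Prop where
  brownian : IsBrownianReal B μ
  adapted : Adapted 𝓕 B
  indep_increments : ∀ u v : ℝ≥0, u ≤ v →
    Indep (MeasurableSpace.comap (fun ω ↦ B v ω - B u ω) inferInstance) (𝓕 u) μ

/-- A simple process `∑_{i < n} ξ i · 𝟙_{(τ i, τ (i + 1)]}` with deterministic times
`τ 0 ≤ ⋯ ≤ τ n` and bounded coefficients, `ξ i` being `𝓕 (τ i)`-measurable. (A further term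
supported on the single time `0` would not contribute to the integral and is omitted.) -/
structure SimpleProcess {Ω : Type*} {mΩ : MeasurableSpace Ω} (𝓕 : Filtration ℝ≥0 mΩ) where
  n : ℕ
  τ : ℕ → ℝ≥0
  ξ : ℕ → Ω → ℝ
  mono : Monotone τ
  measurable : ∀ i, Measurable[𝓕 (τ i)] (ξ i)
  bounded : ∀ i, ∃ C : ℝ, ∀ ω, |ξ i ω| ≤ C

namespace SimpleProcess

variable {Ω : Type*} {mΩ : MeasurableSpace Ω} {𝓕 : Filtration ℝ≥0 mΩ}

/-- The value of a simple process at time `u`. -/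
noncomputable def eval (φ : SimpleProcess 𝓕) (u : ℝ≥0) (ω : Ω) : ℝ :=
  ∑ i ∈ Finset.range φ.n, (Set.Ioc (φ.τ i) (φ.τ (i + 1))).indicator (fun _ ↦ φ.ξ i ω) u

/-- The elementary stochastic integral `∑_{i < n} ξ i · (B_{t ∧ τ (i + 1)} - B_{t ∧ τ i})` of a
simple process over `[0, t]`. -/
noncomputable def integral (φ : SimpleProcess 𝓕) (B : ℝ≥0 → Ω → ℝ) (t : ℝ≥0) (ω : Ω) : ℝ :=
  ∑ i ∈ Finset.range φ.n, φ.ξ i ω * (B (min t (φ.τ (i + 1))) ω - B (min t (φ.τ i)) ω)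

end SimpleProcess

/-- `X` is (a version of) the Itô integral of `f` against `B` over `[0, t]`: there are simple
processes `φ k` with `E ∫₀ᵗ |φ k - f|² du → 0` whose elementary integrals over `[0, t]` converge
to `X` in `L²(μ)`. -/
def IsItoIntegral {Ω : Type*} {mΩ : MeasurableSpace Ω} (𝓕 : Filtration ℝ≥0 mΩ) (μ : Measure Ω)
    (B f : ℝ≥0 → Ω → ℝ) (t : ℝ≥0) (X : Ω → ℝ) : Prop :=
  MemLp X 2 μ ∧ ∃ φ : ℕ → SimpleProcess 𝓕,
    Tendsto (fun k ↦ ∫⁻ ω, ∫⁻ u in Set.Icc (0 : ℝ) t,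
      ‖(φ k).eval u.toNNReal ω - f u.toNNReal ω‖ₑ ^ 2 ∂volume ∂μ)
      atTop (𝓝 0) ∧
    Tendsto (fun k ↦ eLpNorm (fun ω ↦ (φ k).integral B t ω - X ω) 2 μ) atTop (𝓝 0)

open Classical in
/-- The Itô integral `∫₀ᵗ f dB`, as a random variable determined up to almost sure equality. For
`B` a Brownian motion with respect to `𝓕` and `f` measurable, adapted and square-integrable on
`[0, t] × Ω`, the `L²` limit exists; the value `0` is used only where there is no such limit. -/
noncomputable def itoIntegral {Ω : Type*} {mΩ : MeasurableSpace Ω} (𝓕 : Filtration ℝ≥0 mΩ)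
    (μ : Measure Ω) (B f : ℝ≥0 → Ω → ℝ) (t : ℝ≥0) : Ω → ℝ :=
  if h : ∃ X : Ω → ℝ, IsItoIntegral 𝓕 μ B f t X then h.choose else 0

/-!
Write `ℋ u = 𝓕 u ⊔ 𝒢` and `Z = h₁ h₂`, a bounded `ℋ s`-measurable weight. By hypothesis `B₁` and
`B₂` are still Brownian motions with respect to `ℋ` up to time `T`, and the claim follows once `∫ f dB₁ · ∫ g dB₂` is an `ℋ`-martingale on `[0, T]`, which is the case if the bracket
of `B₁` and `B₂` vanishes with respect to `ℋ`.

The hypotheses make each increment independent of `ℋ u`, but not the pair of increments. The bracket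
is nevertheless zero, because it is the limit of the realized covariations
`∑ ΔB₁ ΔB₂`, which do not depend on the filtration and whose second moments, by the independence of
`B₁` and `B₂`, are `∑ (Δu)² → 0` (`bracketPair_of_indepFun`).

The structure `BracketPair` records what is used of two such martingales with bracket `ρ t`. For
`ρ = 0` it gives the claim for simple integrands
(`SimpleProcess.integral_weight_mul_integral_mul_integral`), and for a single Brownian motion
(`ρ = 1`) the Itô isometry (`SimpleProcess.eLpNorm_integral_sub`).

To pass to the limit, the Itô integrals at both times `s` and `t` must be `L²` limits along one
sequence of simple processes. The isometry reduces this (`exists_tendsto_itoIntegral`) to the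
density of simple processes (`exists_tendsto_eLpNorm_simpleProcess`). The integrands are only jointly
measurable and adapted, so they are sampled along a grid `r + δ ℕ`; averaged over `r`, the sampling
error is an average of the errors of translation in time by `w ∈ (0, δ]`, which tend to zero in
`L²`, so that some offset `r` is good enough (`exists_grid_offset`).
-/

/-! ### Pairs of square-integrable processes with linear bracket -/

lemma MeasureTheory.MemLp.bounded_mul {Ω : Type*} {mΩ : MeasurableSpace Ω} {μ : Measure Ω}
    {p : ℝ≥0∞} {ξ X : Ω → ℝ} (hξ : Measurable ξ) (hb : ∃ C : ℝ, ∀ ω, |ξ ω| ≤ C)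
    (hX : MemLp X p μ) : MemLp (fun ω ↦ ξ ω * X ω) p μ := by
  obtain ⟨C, hC⟩ := hb
  refine hX.of_le_mul (c := C) (hξ.aestronglyMeasurable.mul hX.1) (ae_of_all _ fun ω ↦ ?_)
  rw [norm_mul]
  exact mul_le_mul_of_nonneg_right (hC ω) (norm_nonneg _)

lemma exists_abs_mul_le {Ω : Type*} {ξ η : Ω → ℝ} (hξ : ∃ C : ℝ, ∀ ω, |ξ ω| ≤ C)
    (hη : ∃ C : ℝ, ∀ ω, |η ω| ≤ C) : ∃ C : ℝ, ∀ ω, |ξ ω * η ω| ≤ C := by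
  obtain ⟨C, hC⟩ := hξ
  obtain ⟨D, hD⟩ := hη
  refine ⟨C * D, fun ω ↦ ?_⟩
  rw [abs_mul]
  exact mul_le_mul (hC ω) (hD ω) (abs_nonneg _) ((abs_nonneg _).trans (hC ω))

/-- `B` and `B'` are square-integrable and adapted to `ℋ`, their increments up to time `T` are
orthogonal to the past, and the product of their increments over `(u, v]` has conditional
expectation `ρ * (v - u)` given `ℋ u`: two martingales on `[0, T]` with bracket `ρ * t`. -/
structure BracketPair {Ω : Type*} {mΩ : MeasurableSpace Ω} (ℋ : Filtration ℝ≥0 mΩ)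
    (μ : Measure Ω) (T : ℝ≥0) (B B' : ℝ≥0 → Ω → ℝ) (ρ : ℝ) : Prop where
  adapted_left : Adapted ℋ B
  adapted_right : Adapted ℋ B'
  memLp_left : ∀ u, MemLp (B u) 2 μ
  memLp_right : ∀ u, MemLp (B' u) 2 μ
  left_zero : ∀ u v, u ≤ v → v ≤ T → ∀ Z : Ω → ℝ, Measurable[ℋ u] Z →
    ∫ ω, Z ω * (B v ω - B u ω) ∂μ = 0
  right_zero : ∀ u v, u ≤ v → v ≤ T → ∀ Z : Ω → ℝ, Measurable[ℋ u] Z →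
    ∫ ω, Z ω * (B' v ω - B' u ω) ∂μ = 0
  bracket : ∀ u v, u ≤ v → v ≤ T → ∀ Z : Ω → ℝ, Measurable[ℋ u] Z →
    (∃ C : ℝ, ∀ ω, |Z ω| ≤ C) →
    ∫ ω, Z ω * ((B v ω - B u ω) * (B' v ω - B' u ω)) ∂μ = ρ * (v - u) * ∫ ω, Z ω ∂μ

namespace BracketPair

variable {Ω : Type*} {mΩ : MeasurableSpace Ω} {ℋ : Filtration ℝ≥0 mΩ} {μ : Measure Ω}
  {T : ℝ≥0} {B B' : ℝ≥0 → Ω → ℝ} {ρ : ℝ}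

lemma symm (h : BracketPair ℋ μ T B B' ρ) : BracketPair ℋ μ T B' B ρ where
  adapted_left := h.adapted_right
  adapted_right := h.adapted_left
  memLp_left := h.memLp_right
  memLp_right := h.memLp_left
  left_zero := h.right_zero
  right_zero := h.left_zero
  bracket u v huv hv Z hZ hb := by
    rw [← h.bracket u v huv hv Z hZ hb]
    simp only [mul_comm]

lemma measurable_increment (h : BracketPair ℋ μ T B B' ρ) {a b c : ℝ≥0} (ha : a ≤ c)
    (hb : b ≤ c) : Measurable[ℋ c] (fun ω ↦ B b ω - B a ω) :=
  Measurable.sub ((h.adapted_left b).mono (ℋ.mono hb) le_rfl)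
    ((h.adapted_left a).mono (ℋ.mono ha) le_rfl)

lemma memLp_atom (h : BracketPair ℋ μ T B B' ρ) {a b c : ℝ≥0} {ξ : Ω → ℝ}
    (hξ : Measurable[ℋ c] ξ) (hξb : ∃ C : ℝ, ∀ ω, |ξ ω| ≤ C) :
    MemLp (fun ω ↦ ξ ω * (B b ω - B a ω)) 2 μ :=
  ((h.memLp_left b).sub (h.memLp_left a)).bounded_mul (hξ.mono (ℋ.le c) le_rfl) hξb

lemma integrable_atom_mul_atom (h : BracketPair ℋ μ T B B' ρ) {a b a' c d c' : ℝ≥0}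
    {ξ η : Ω → ℝ} (hξ : Measurable[ℋ a'] ξ) (hξb : ∃ C : ℝ, ∀ ω, |ξ ω| ≤ C)
    (hη : Measurable[ℋ c'] η) (hηb : ∃ C : ℝ, ∀ ω, |η ω| ≤ C) :
    Integrable (fun ω ↦ (ξ ω * (B b ω - B a ω)) * (η ω * (B' d ω - B' c ω))) μ :=
  (h.memLp_atom hξ hξb).integrable_mul (h.symm.memLp_atom hη hηb)

/-- The case of two increments that end at the same time `b`. -/
lemma integral_mul_of_common_end (h : BracketPair ℋ μ T B B' ρ) {a b c : ℝ≥0} (hac : a ≤ c)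
    (hcb : c ≤ b) (hb : b ≤ T) {ξ η : Ω → ℝ} (hξ : Measurable[ℋ a] ξ)
    (hξb : ∃ C : ℝ, ∀ ω, |ξ ω| ≤ C) (hη : Measurable[ℋ c] η) (hηb : ∃ C : ℝ, ∀ ω, |η ω| ≤ C) :
    ∫ ω, (ξ ω * (B b ω - B a ω)) * (η ω * (B' b ω - B' c ω)) ∂μ =
      ρ * (b - c) * ∫ ω, ξ ω * η ω ∂μ := by
  have hξc : Measurable[ℋ c] ξ := hξ.mono (ℋ.mono hac) le_rfl
  have e : ∀ ω, (ξ ω * (B b ω - B a ω)) * (η ω * (B' b ω - B' c ω)) =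
      (ξ ω * (B b ω - B c ω)) * (η ω * (B' b ω - B' c ω)) +
      (ξ ω * (B c ω - B a ω)) * (η ω * (B' b ω - B' c ω)) := fun ω ↦ by ring
  simp_rw [e]
  rw [integral_add (h.integrable_atom_mul_atom hξ hξb hη hηb)
    (h.integrable_atom_mul_atom hξ hξb hη hηb)]
  have h1 := h.bracket c b hcb hb (fun ω ↦ ξ ω * η ω) (Measurable.mul hξc hη)
    (exists_abs_mul_le hξb hηb)
  have h2 := h.right_zero c b hcb hb (fun ω ↦ ξ ω * (B c ω - B a ω) * η ω)
    (Measurable.mul (Measurable.mul hξc (h.measurable_increment hac le_rfl)) hη)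
  rw [← h1, ← add_zero (∫ ω, ξ ω * η ω * _ ∂μ), ← h2]
  congr 1 <;> congr 1 <;> ext ω <;> ring

lemma integral_mul_of_end_le (h : BracketPair ℋ μ T B B' ρ) {a b c d : ℝ≥0} (hab : a ≤ b)
    (hcd : c ≤ d) (hbd : b ≤ d) (hd : d ≤ T) {ξ η : Ω → ℝ} (hξ : Measurable[ℋ a] ξ)
    (hξb : ∃ C : ℝ, ∀ ω, |ξ ω| ≤ C) (hη : Measurable[ℋ c] η) (hηb : ∃ C : ℝ, ∀ ω, |η ω| ≤ C) :
    ∫ ω, (ξ ω * (B b ω - B a ω)) * (η ω * (B' d ω - B' c ω)) ∂μ =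
      ρ * ((min b d - max a c : ℝ≥0) : ℝ) * ∫ ω, ξ ω * η ω ∂μ := by
  have key : ∀ e : ℝ≥0, e ≤ d → b ≤ e → c ≤ e →
      ∫ ω, (ξ ω * (B b ω - B a ω)) * (η ω * (B' d ω - B' e ω)) ∂μ = 0 := by
    intro e hed hbe hce
    rw [← h.right_zero e d hed hd (fun ω ↦ ξ ω * (B b ω - B a ω) * η ω)
      (Measurable.mul (Measurable.mul (hξ.mono (ℋ.mono (hab.trans hbe)) le_rfl)
        (h.measurable_increment (hab.trans hbe) hbe)) (hη.mono (ℋ.mono hce) le_rfl))]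
    congr 1; ext ω; ring
  rw [min_eq_left hbd]
  rcases le_total b c with hbc | hcb
  · rw [key c hcd hbc le_rfl, tsub_eq_zero_of_le (hbc.trans (le_max_right a c))]
    simp
  have e : ∀ ω, (ξ ω * (B b ω - B a ω)) * (η ω * (B' d ω - B' c ω)) =
      (ξ ω * (B b ω - B a ω)) * (η ω * (B' b ω - B' c ω)) +
      (ξ ω * (B b ω - B a ω)) * (η ω * (B' d ω - B' b ω)) := fun ω ↦ by ring
  simp_rw [e]
  rw [integral_add (h.integrable_atom_mul_atom hξ hξb hη hηb)
    (h.integrable_atom_mul_atom hξ hξb hη hηb), key b hbd le_rfl hcb,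
    add_zero]
  rcases le_total a c with hac | hca
  · rw [h.integral_mul_of_common_end hac hcb (hbd.trans hd) hξ hξb hη hηb, max_eq_right hac,
      NNReal.coe_sub hcb]
  · have := h.symm.integral_mul_of_common_end hca hab (hbd.trans hd) hη hηb hξ hξb
    rw [max_eq_left hca, NNReal.coe_sub hab]
    simpa only [mul_comm, mul_left_comm, mul_assoc] using this

/-- Covariance of two increments with random coefficients: only the overlap of the two time
intervals contributes. Measurability of a coefficient is not needed over an empty interval. -/
lemma integral_mul_atoms (h : BracketPair ℋ μ T B B' ρ) {a b c d : ℝ≥0} (hab : a ≤ b)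
    (hcd : c ≤ d) (hb : b ≤ T) (hd : d ≤ T) {ξ η : Ω → ℝ} (hξ : a < b → Measurable[ℋ a] ξ)
    (hξb : ∃ C : ℝ, ∀ ω, |ξ ω| ≤ C) (hη : c < d → Measurable[ℋ c] η)
    (hηb : ∃ C : ℝ, ∀ ω, |η ω| ≤ C) :
    ∫ ω, (ξ ω * (B b ω - B a ω)) * (η ω * (B' d ω - B' c ω)) ∂μ =
      ρ * ((min b d - max a c : ℝ≥0) : ℝ) * ∫ ω, ξ ω * η ω ∂μ := by
  rcases hab.eq_or_lt with rfl | hab'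
  · rw [tsub_eq_zero_of_le ((min_le_left _ _).trans (le_max_left _ _))]
    simp
  rcases hcd.eq_or_lt with rfl | hcd'
  · rw [tsub_eq_zero_of_le ((min_le_right _ _).trans (le_max_right _ _))]
    simp
  rcases le_total b d with hbd | hdb
  · exact h.integral_mul_of_end_le hab hcd hbd hd (hξ hab') hξb (hη hcd') hηb
  · have := h.symm.integral_mul_of_end_le hcd hab hdb hb (hη hcd') hηb (hξ hab') hξb
    rw [min_comm, max_comm]
    simpa only [mul_comm, mul_left_comm, mul_assoc] using this

end BracketPair

/-! ### Brownian motions and their brackets in an enlarged filtration -/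

section Brownian

variable {Ω : Type*} {mΩ : MeasurableSpace Ω} {μ : Measure Ω} {B B₁ B₂ : ℝ≥0 → Ω → ℝ}
  {ℋ : Filtration ℝ≥0 mΩ} {T : ℝ≥0}

lemma ProbabilityTheory.IsPreBrownianReal.memLp_two (hB : IsPreBrownianReal B μ) (u : ℝ≥0) :
    MemLp (B u) 2 μ :=
  (hB.isGaussianProcess.hasGaussianLaw_eval u).memLp_two

lemma ProbabilityTheory.IsPreBrownianReal.integral_increment (hB : IsPreBrownianReal B μ)
    (u v : ℝ≥0) :
    ∫ ω, (B v ω - B u ω) ∂μ = 0 := by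
  rw [integral_sub (hB.integrable_eval v) (hB.integrable_eval u), hB.integral_eval,
    hB.integral_eval, sub_zero]

lemma ProbabilityTheory.IsPreBrownianReal.integral_increment_sq (hB : IsPreBrownianReal B μ)
    {u v : ℝ≥0}
    (huv : u ≤ v) : ∫ ω, (B v ω - B u ω) * (B v ω - B u ω) ∂μ = v - u := by
  have h := hB.hasLaw_sub v u
  have hv := h.variance_eq
  rw [variance_id_gaussianReal, variance_of_integral_eq_zero h.aemeasurable
    (hB.integral_increment u v)] at hv
  have hd : ((nndist v.1 u.1 : ℝ≥0) : ℝ) = v - u := by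
    rw [coe_nndist, Real.dist_eq]
    exact abs_of_nonneg (sub_nonneg.2 (NNReal.coe_le_coe.2 huv))
  rw [← hd, ← hv]
  refine integral_congr_ae (ae_of_all _ fun ω ↦ ?_)
  simp only [Pi.sub_apply]
  ring

lemma integral_mul_increment_of_indep [IsProbabilityMeasure μ] (hB : IsPreBrownianReal B μ)
    {u v : ℝ≥0}
    (hi : Indep (MeasurableSpace.comap (fun ω ↦ B v ω - B u ω) inferInstance) (ℋ u) μ)
    {Z : Ω → ℝ} (hZ : Measurable[ℋ u] Z) : ∫ ω, Z ω * (B v ω - B u ω) ∂μ = 0 := by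
  have hind : IndepFun Z (fun ω ↦ B v ω - B u ω) μ :=
    (IndepFun_iff_Indep _ _ _).2 (indep_of_indep_of_le_left hi.symm hZ.comap_le)
  rw [hind.integral_fun_mul_eq_mul_integral (hZ.mono (ℋ.le u) le_rfl).aestronglyMeasurable
    ((hB.memLp_two v).1.sub (hB.memLp_two u).1), hB.integral_increment, mul_zero]

/-- A Brownian motion paired with itself has bracket `t`. -/
lemma bracketPair_self [IsProbabilityMeasure μ] (hB : IsPreBrownianReal B μ) (had : Adapted ℋ B)
    (hi : ∀ u v : ℝ≥0, u ≤ v → v ≤ T →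
      Indep (MeasurableSpace.comap (fun ω ↦ B v ω - B u ω) inferInstance) (ℋ u) μ) :
    BracketPair ℋ μ T B B 1 where
  adapted_left := had
  adapted_right := had
  memLp_left := hB.memLp_two
  memLp_right := hB.memLp_two
  left_zero u v huv hv Z hZ := integral_mul_increment_of_indep hB (hi u v huv hv) hZ
  right_zero u v huv hv Z hZ := integral_mul_increment_of_indep hB (hi u v huv hv) hZ
  bracket u v huv hv Z hZ _ := by
    have hind : IndepFun Z (fun ω ↦ B v ω - B u ω) μ :=
      (IndepFun_iff_Indep _ _ _).2 (indep_of_indep_of_le_left (hi u v huv hv).symm hZ.comap_le)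
    have hind' := hind.comp measurable_id (measurable_id.mul measurable_id)
    have hD := (hB.memLp_two v).1.sub (hB.memLp_two u).1
    have := hind'.integral_fun_mul_eq_mul_integral
      (hZ.mono (ℋ.le u) le_rfl).aestronglyMeasurable (hD.mul hD)
    refine this.trans ?_
    rw [one_mul, mul_comm]
    congr 1
    exact hB.integral_increment_sq huv

variable [IsProbabilityMeasure μ]

/-- The realized covariation of two independent Brownian motions over the partition `σ` has second
moment `∑ (σ (k + 1) - σ k)²`, since distinct increments of `B₁` are orthogonal. -/
lemma integral_sum_mul_increments_sq (hB₁ : IsPreBrownianReal B₁ μ) (hB₂ : IsPreBrownianReal B₂ μ)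
    (had₁ : Adapted ℋ B₁)
    (hi₁ : ∀ u v : ℝ≥0, u ≤ v → v ≤ T →
      Indep (MeasurableSpace.comap (fun ω ↦ B₁ v ω - B₁ u ω) inferInstance) (ℋ u) μ)
    (hB : IndepFun (fun ω u ↦ B₁ u ω) (fun ω u ↦ B₂ u ω) μ)
    {σ : ℕ → ℝ≥0} (hσ : Monotone σ) (hσT : ∀ k, σ k ≤ T) (n : ℕ) :
    MemLp (fun ω ↦ ∑ k ∈ Finset.range n,
      (B₁ (σ (k + 1)) ω - B₁ (σ k) ω) * (B₂ (σ (k + 1)) ω - B₂ (σ k) ω)) 2 μ ∧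
    ∫ ω, (∑ k ∈ Finset.range n,
      (B₁ (σ (k + 1)) ω - B₁ (σ k) ω) * (B₂ (σ (k + 1)) ω - B₂ (σ k) ω)) ^ 2 ∂μ =
      ∑ k ∈ Finset.range n, ((σ (k + 1) : ℝ) - σ k) ^ 2 := by
  have hpair := bracketPair_self hB₁ had₁ hi₁
  set x : ℕ → Ω → ℝ := fun k ω ↦ B₁ (σ (k + 1)) ω - B₁ (σ k) ω with hx
  set y : ℕ → Ω → ℝ := fun k ω ↦ B₂ (σ (k + 1)) ω - B₂ (σ k) ω with hy
  have hxL : ∀ k, MemLp (x k) 2 μ := fun k ↦ (hB₁.memLp_two _).sub (hB₁.memLp_two _)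
  have hyL : ∀ k, MemLp (y k) 2 μ := fun k ↦ (hB₂.memLp_two _).sub (hB₂.memLp_two _)
  have hind : ∀ k l, IndepFun (fun ω ↦ x k ω * x l ω) (fun ω ↦ y k ω * y l ω) μ := by
    intro k l
    have hφ : Measurable (fun p : ℝ≥0 → ℝ ↦
        (p (σ (k + 1)) - p (σ k)) * (p (σ (l + 1)) - p (σ l))) := by fun_prop
    exact hB.comp hφ hφ
  have hterm : ∀ k l, Integrable (fun ω ↦ (x k ω * y k ω) * (x l ω * y l ω)) μ := by
    intro k l
    have := (hind k l).integrable_mul ((hxL k).integrable_mul (hxL l))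
      ((hyL k).integrable_mul (hyL l))
    refine this.congr (ae_of_all _ fun ω ↦ ?_)
    simp only [Pi.mul_apply]; ring
  have hL : ∀ k, MemLp (fun ω ↦ x k ω * y k ω) 2 μ := by
    intro k
    refine (memLp_two_iff_integrable_sq ((hxL k).1.mul (hyL k).1)).2 ?_
    simpa only [sq, Pi.mul_apply] using hterm k k
  have hval : ∀ k l, ∫ ω, (x k ω * y k ω) * (x l ω * y l ω) ∂μ =
      if k = l then ((σ (k + 1) : ℝ) - σ k) ^ 2 else 0 := by
    intro k l
    have e : ∫ ω, (x k ω * y k ω) * (x l ω * y l ω) ∂μ =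
        (∫ ω, x k ω * x l ω ∂μ) * ∫ ω, y k ω * y l ω ∂μ := by
      rw [← (hind k l).integral_fun_mul_eq_mul_integral ((hxL k).1.mul (hxL l).1)
        ((hyL k).1.mul (hyL l).1)]
      congr 1; ext ω; ring
    rw [e]
    split_ifs with hkl
    · subst hkl
      rw [hB₁.integral_increment_sq (hσ k.le_succ), hB₂.integral_increment_sq (hσ k.le_succ), sq]
    · suffices h0 : ∫ ω, x k ω * x l ω ∂μ = 0 by rw [h0, zero_mul]
      have := hpair.integral_mul_atoms (hσ k.le_succ) (hσ l.le_succ) (hσT _) (hσT _)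
        (ξ := fun _ ↦ 1) (η := fun _ ↦ 1) (fun _ ↦ measurable_const) ⟨1, by simp⟩
        (fun _ ↦ measurable_const) ⟨1, by simp⟩
      have hover : min (σ (k + 1)) (σ (l + 1)) ≤ max (σ k) (σ l) := by
        rcases Ne.lt_or_gt hkl with h | h
        · exact (min_le_left _ _).trans ((hσ h).trans (le_max_right _ _))
        · exact (min_le_right _ _).trans ((hσ h).trans (le_max_left _ _))
      rw [tsub_eq_zero_of_le hover] at this
      simpa using this
  refine ⟨memLp_finsetSum _ fun k _ ↦ hL k, ?_⟩
  simp_rw [sq (∑ k ∈ Finset.range n, _), Finset.sum_mul_sum]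
  rw [integral_finsetSum _ fun k _ ↦ integrable_finsetSum _ fun l _ ↦ hterm k l]
  refine Finset.sum_congr rfl fun k hk ↦ ?_
  rw [integral_finsetSum _ fun l _ ↦ hterm k l]
  simp_rw [hval]
  rw [Finset.sum_ite_eq, if_pos hk]

/-- Two independent Brownian motions, each with increments independent of the past of `ℋ`, have
bracket zero with respect to `ℋ`. The two increments are not assumed jointly independent of
`ℋ u`; but over a partition of `(u, v]` the cross terms vanish by orthogonality to the past, so
that the covariation against `Z` is that of the realized covariation, which tends to zero in `L²`
as the mesh does, whatever the filtration. -/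
lemma bracketPair_of_indepFun (hB₁ : IsPreBrownianReal B₁ μ) (hB₂ : IsPreBrownianReal B₂ μ)
    (had₁ : Adapted ℋ B₁) (had₂ : Adapted ℋ B₂)
    (hi₁ : ∀ u v : ℝ≥0, u ≤ v → v ≤ T →
      Indep (MeasurableSpace.comap (fun ω ↦ B₁ v ω - B₁ u ω) inferInstance) (ℋ u) μ)
    (hi₂ : ∀ u v : ℝ≥0, u ≤ v → v ≤ T →
      Indep (MeasurableSpace.comap (fun ω ↦ B₂ v ω - B₂ u ω) inferInstance) (ℋ u) μ)
    (hB : IndepFun (fun ω u ↦ B₁ u ω) (fun ω u ↦ B₂ u ω) μ) :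
    BracketPair ℋ μ T B₁ B₂ 0 where
  adapted_left := had₁
  adapted_right := had₂
  memLp_left := hB₁.memLp_two
  memLp_right := hB₂.memLp_two
  left_zero u v huv hv Z hZ := integral_mul_increment_of_indep hB₁ (hi₁ u v huv hv) hZ
  right_zero u v huv hv Z hZ := integral_mul_increment_of_indep hB₂ (hi₂ u v huv hv) hZ
  bracket u v huv hv Z hZ hZb := by
    rw [zero_mul, zero_mul]
    have hZm : Measurable Z := hZ.mono (ℋ.le u) le_rfl
    -- additivity of the covariation over consecutive intervals
    have hadd : ∀ a b : ℝ≥0, u ≤ a → a ≤ b → b ≤ T →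
        ∫ ω, Z ω * ((B₁ b ω - B₁ u ω) * (B₂ b ω - B₂ u ω)) ∂μ =
          ∫ ω, Z ω * ((B₁ a ω - B₁ u ω) * (B₂ a ω - B₂ u ω)) ∂μ +
          ∫ ω, Z ω * ((B₁ b ω - B₁ a ω) * (B₂ b ω - B₂ a ω)) ∂μ := by
      intro a b hua hab hb
      have hint : ∀ p q r s : ℝ≥0,
          Integrable (fun ω ↦ Z ω * ((B₁ p ω - B₁ q ω) * (B₂ r ω - B₂ s ω))) μ := by
        intro p q r s
        have := (((hB₁.memLp_two p).sub (hB₁.memLp_two q)).bounded_mul hZm hZb).integrable_mul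
          ((hB₂.memLp_two r).sub (hB₂.memLp_two s))
        refine this.congr (ae_of_all _ fun ω ↦ ?_)
        simp only [Pi.mul_apply, Pi.sub_apply]; ring
      have hZa : Measurable[ℋ a] Z := hZ.mono (ℋ.mono hua) le_rfl
      have h₁ := integral_mul_increment_of_indep hB₁ (hi₁ a b hab hb)
        (Z := fun ω ↦ Z ω * (B₂ a ω - B₂ u ω))
        (Measurable.mul hZa (Measurable.sub (had₂ a) ((had₂ u).mono (ℋ.mono hua) le_rfl)))
      have h₂ := integral_mul_increment_of_indep hB₂ (hi₂ a b hab hb)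
        (Z := fun ω ↦ Z ω * (B₁ a ω - B₁ u ω))
        (Measurable.mul hZa (Measurable.sub (had₁ a) ((had₁ u).mono (ℋ.mono hua) le_rfl)))
      have e₁ : ∫ ω, Z ω * ((B₁ b ω - B₁ a ω) * (B₂ a ω - B₂ u ω)) ∂μ = 0 := by
        rw [← h₁]; congr 1; ext ω; ring
      have e₂ : ∫ ω, Z ω * ((B₁ a ω - B₁ u ω) * (B₂ b ω - B₂ a ω)) ∂μ = 0 := by
        rw [← h₂]; congr 1; ext ω; ring
      have e : ∀ ω, Z ω * ((B₁ b ω - B₁ u ω) * (B₂ b ω - B₂ u ω)) =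
          (Z ω * ((B₁ a ω - B₁ u ω) * (B₂ a ω - B₂ u ω)) +
            Z ω * ((B₁ b ω - B₁ a ω) * (B₂ b ω - B₂ a ω))) +
          (Z ω * ((B₁ b ω - B₁ a ω) * (B₂ a ω - B₂ u ω)) +
            Z ω * ((B₁ a ω - B₁ u ω) * (B₂ b ω - B₂ a ω))) := fun ω ↦ by ring
      have hsum : ∀ {F G : Ω → ℝ}, Integrable F μ → Integrable G μ →
          Integrable (fun ω ↦ F ω + G ω) μ := fun hF hG ↦ hF.add hG
      simp_rw [e]
      rw [integral_add (hsum (hint _ _ _ _) (hint _ _ _ _)) (hsum (hint _ _ _ _) (hint _ _ _ _)),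
        integral_add (hint _ _ _ _) (hint _ _ _ _), integral_add (hint _ _ _ _) (hint _ _ _ _),
        e₁, e₂, add_zero, add_zero]
    set I := ∫ ω, Z ω * ((B₁ v ω - B₁ u ω) * (B₂ v ω - B₂ u ω)) ∂μ with hI
    obtain ⟨C, hC⟩ := hZb
    have hbound : ∀ n : ℕ, I ^ 2 ≤ C ^ 2 * ((v : ℝ) - u) ^ 2 / (n + 1) := by
      intro n
      -- the uniform partition of `[u, v]` into `n + 1` intervals, constant after its last point
      set σ : ℕ → ℝ≥0 := fun k ↦ u + (min k (n + 1) : ℕ) * ((v - u) / (n + 1)) with hσdef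
      have hσ : Monotone σ := by
        intro k l hkl
        simp only [hσdef]
        gcongr
      have hσ0 : σ 0 = u := by simp [hσdef]
      have hσn : σ (n + 1) = v := by
        simp only [hσdef, min_self]
        rw [Nat.cast_add, Nat.cast_one, mul_div_cancel₀ _ (by positivity),
          add_tsub_cancel_of_le huv]
      have hσT : ∀ k, σ k ≤ T := by
        intro k
        have hk : σ k = σ (min k (n + 1)) := by simp only [hσdef, min_assoc, min_self]
        rw [hk]
        exact ((hσ (min_le_right _ _)).trans_eq hσn).trans hv
      have hstep : ∀ k ∈ Finset.range (n + 1),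
          ((σ (k + 1) : ℝ) - σ k) ^ 2 = (((v : ℝ) - u) / (n + 1)) ^ 2 := by
        intro k hk
        have hk' := Finset.mem_range.1 hk
        simp only [hσdef]
        rw [min_eq_left (by omega : k + 1 ≤ n + 1), min_eq_left (by omega : k ≤ n + 1)]
        push_cast [NNReal.coe_sub huv]
        ring
      obtain ⟨hSL, hS⟩ := integral_sum_mul_increments_sq hB₁ hB₂ had₁ hi₁ hB hσ hσT (n + 1)
      set S : Ω → ℝ := fun ω ↦ ∑ k ∈ Finset.range (n + 1),
        (B₁ (σ (k + 1)) ω - B₁ (σ k) ω) * (B₂ (σ (k + 1)) ω - B₂ (σ k) ω) with hSdef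
      rw [Finset.sum_congr rfl hstep, Finset.sum_const, Finset.card_range, nsmul_eq_mul] at hS
      have hint : ∀ k, Integrable (fun ω ↦ Z ω *
          ((B₁ (σ (k + 1)) ω - B₁ (σ k) ω) * (B₂ (σ (k + 1)) ω - B₂ (σ k) ω))) μ := by
        intro k
        have := (((hB₁.memLp_two (σ (k + 1))).sub (hB₁.memLp_two (σ k))).bounded_mul
          hZm ⟨C, hC⟩).integrable_mul ((hB₂.memLp_two (σ (k + 1))).sub (hB₂.memLp_two (σ k)))
        refine this.congr (ae_of_all _ fun ω ↦ ?_)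
        simp only [Pi.mul_apply, Pi.sub_apply]; ring
      have hpart : ∀ m, ∫ ω, Z ω * ((B₁ (σ m) ω - B₁ u ω) * (B₂ (σ m) ω - B₂ u ω)) ∂μ =
          ∑ k ∈ Finset.range m, ∫ ω, Z ω *
            ((B₁ (σ (k + 1)) ω - B₁ (σ k) ω) * (B₂ (σ (k + 1)) ω - B₂ (σ k) ω)) ∂μ := by
        intro m
        induction m with
        | zero => simp [hσ0]
        | succ m ih =>
          rw [Finset.sum_range_succ, ← ih]
          exact hadd _ _ (hσ0 ▸ hσ (Nat.zero_le m)) (hσ m.le_succ) (hσT _)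
      have hIS : I = ∫ ω, Z ω * S ω ∂μ := by
        rw [hI, ← hσn, hpart, ← integral_finsetSum _ fun k _ ↦ hint k]
        simp only [hSdef, Finset.mul_sum]
      have hZS := hSL.bounded_mul hZm ⟨C, hC⟩
      -- the square of a mean is at most the mean of the square
      have hvar : (∫ ω, Z ω * S ω ∂μ) ^ 2 ≤ ∫ ω, (Z ω * S ω) ^ 2 ∂μ := by
        have h0 := variance_nonneg (fun ω ↦ Z ω * S ω) μ
        rw [variance_eq_sub hZS] at h0
        simpa using h0
      rw [hIS]
      refine hvar.trans ?_
      calc ∫ ω, (Z ω * S ω) ^ 2 ∂μ ≤ ∫ ω, C ^ 2 * S ω ^ 2 ∂μ := by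
            refine integral_mono hZS.integrable_sq (hSL.integrable_sq.const_mul _) fun ω ↦ ?_
            simp only [mul_pow]
            refine mul_le_mul_of_nonneg_right ?_ (sq_nonneg _)
            exact sq_le_sq' (neg_le_of_abs_le (hC ω)) (le_of_abs_le (hC ω))
        _ = C ^ 2 * ((v : ℝ) - u) ^ 2 / (n + 1) := by
            rw [integral_const_mul, hS]
            push_cast
            field_simp
    have hlim : Tendsto (fun n : ℕ ↦ C ^ 2 * ((v : ℝ) - u) ^ 2 / (n + 1)) atTop (𝓝 0) :=
      ((tendsto_const_div_atTop_nhds_zero_nat (C ^ 2 * ((v : ℝ) - u) ^ 2)).comp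
        (tendsto_add_atTop_nat 1)).congr fun n ↦ by simp
    have := ge_of_tendsto' hlim hbound
    exact pow_eq_zero_iff two_ne_zero |>.1 (le_antisymm this (sq_nonneg _))

end Brownian

/-! ### Elementary integrals: covariance and the Itô isometry -/

/-- The product measure `μ ⊗ du` on `Ω × [0, t]`, as a measure on `Ω × ℝ`. -/
noncomputable abbrev timeProd {Ω : Type*} {mΩ : MeasurableSpace Ω} (μ : Measure Ω) (t : ℝ≥0) :
    Measure (Ω × ℝ) :=
  μ.prod (volume.restrict (Set.Icc (0 : ℝ) t))

/-- A process as a function on `Ω × ℝ`; negative times are sent to time `0`. -/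
def jointFun {Ω : Type*} (f : ℝ≥0 → Ω → ℝ) (p : Ω × ℝ) : ℝ := f p.2.toNNReal p.1

lemma MeasureTheory.MemLp.eLpNorm_two_eq_of_integral_mul_self {α β : Type*}
    {mα : MeasurableSpace α} {mβ : MeasurableSpace β} {μ : Measure α} {ν : Measure β}
    {f : α → ℝ} {g : β → ℝ} (hf : MemLp f 2 μ) (hg : MemLp g 2 ν)
    (h : ∫ x, f x * f x ∂μ = ∫ y, g y * g y ∂ν) : eLpNorm f 2 μ = eLpNorm g 2 ν := by
  rw [hf.eLpNorm_eq_integral_rpow_norm two_ne_zero ENNReal.ofNat_ne_top,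
    hg.eLpNorm_eq_integral_rpow_norm two_ne_zero ENNReal.ofNat_ne_top]
  simp only [ENNReal.toReal_ofNat, Real.rpow_ofNat, Real.norm_eq_abs, sq_abs]
  simp only [sq, h]

lemma MeasureTheory.MemLp.integral_sub_mul_self {α : Type*} {mα : MeasurableSpace α}
    {ν : Measure α} {x y : α → ℝ} (hx : MemLp x 2 ν) (hy : MemLp y 2 ν) :
    ∫ a, (x - y) a * (x - y) a ∂ν =
      ∫ a, x a * x a ∂ν - ∫ a, x a * y a ∂ν - (∫ a, y a * x a ∂ν - ∫ a, y a * y a ∂ν) := by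
  have hm : ∀ {x y : α → ℝ}, MemLp x 2 ν → MemLp y 2 ν → Integrable (fun a ↦ x a * y a) ν :=
    fun hx hy ↦ hx.integrable_mul hy
  have e : ∀ a, (x - y) a * (x - y) a = x a * (x - y) a - y a * (x - y) a := fun a ↦ by
    simp only [Pi.sub_apply]; ring
  simp_rw [e]
  rw [integral_sub (hm hx (hx.sub hy)) (hm hy (hx.sub hy)),
    ← integral_sub (hm hx hx) (hm hx hy), ← integral_sub (hm hy hx) (hm hy hy)]
  simp only [Pi.sub_apply, mul_sub]

lemma eLpNorm_two_sq {α : Type*} {mα : MeasurableSpace α} {μ : Measure α} (f : α → ℝ) :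
    eLpNorm f 2 μ ^ 2 = ∫⁻ x, ‖f x‖ₑ ^ 2 ∂μ := by
  have := eLpNorm_nnreal_pow_eq_lintegral (μ := μ) (f := f) (p := 2) two_ne_zero
  simpa using this

lemma tendsto_eLpNorm_two_iff {α : Type*} {mα : MeasurableSpace α} {ν : Measure α}
    {f : ℕ → α → ℝ} : Tendsto (fun k ↦ eLpNorm (f k) 2 ν ^ 2) atTop (𝓝 0) ↔
      Tendsto (fun k ↦ eLpNorm (f k) 2 ν) atTop (𝓝 0) := by
  refine ⟨fun h ↦ ?_, fun h ↦ by simpa using ENNReal.Tendsto.pow (n := 2) h⟩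
  have := (ENNReal.continuous_rpow_const (y := 1 / 2)).tendsto 0 |>.comp h
  rw [ENNReal.zero_rpow_of_pos (by norm_num)] at this
  refine this.congr fun k ↦ ?_
  rw [Function.comp_apply, ← ENNReal.rpow_natCast, ← ENNReal.rpow_mul]
  norm_num

lemma lintegral_lintegral_enorm_sq {Ω : Type*} {mΩ : MeasurableSpace Ω} {μ : Measure Ω}
    {t : ℝ≥0} {F : Ω × ℝ → ℝ} (hF : AEStronglyMeasurable F (timeProd μ t)) :
    ∫⁻ ω, ∫⁻ u in Set.Icc (0 : ℝ) t, ‖F (ω, u)‖ₑ ^ 2 ∂volume ∂μ =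
      eLpNorm F 2 (timeProd μ t) ^ 2 := by
  rw [eLpNorm_two_sq, lintegral_prod _ (hF.enorm.pow_const 2)]

/-- Both indicators are those of intervals with nonnegative end points, so that truncation of
negative times to `0` does not matter. -/
lemma integral_indicator_Ioc_mul (a b c d t : ℝ≥0) :
    ∫ u in Set.Icc (0 : ℝ) t, (Set.Ioc a b).indicator (fun _ ↦ (1 : ℝ)) u.toNNReal *
      (Set.Ioc c d).indicator (fun _ ↦ (1 : ℝ)) u.toNNReal =
    ((min (min t b) (min t d) - max (min t a) (min t c) : ℝ≥0) : ℝ) := by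
  have h : ∀ u : ℝ, (Set.Icc (0 : ℝ) t).indicator (fun u ↦
      (Set.Ioc a b).indicator (fun _ ↦ (1 : ℝ)) u.toNNReal *
      (Set.Ioc c d).indicator (fun _ ↦ (1 : ℝ)) u.toNNReal) u =
      (Set.Ioc ((max (min t a) (min t c) : ℝ≥0) : ℝ) (min (min t b) (min t d) : ℝ≥0)).indicator
        (fun _ ↦ (1 : ℝ)) u := by
    intro u
    rcases lt_or_ge u 0 with hu | hu
    · rw [Set.indicator_of_notMem (by simp [hu]), Set.indicator_of_notMem]
      intro hmem
      exact absurd ((NNReal.coe_nonneg _).trans_lt hmem.1) (not_lt.2 hu.le)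
    · lift u to ℝ≥0 using hu
      simp only [Set.indicator_apply, Set.mem_Icc, Set.mem_Ioc, Real.toNNReal_coe,
        NNReal.coe_le_coe, NNReal.coe_lt_coe, NNReal.coe_nonneg, true_and, max_lt_iff,
        le_min_iff, min_lt_iff]
      by_cases h1 : u ≤ t
      · have h2 : ¬ t < u := not_lt.2 h1
        by_cases h3 : a < u <;> by_cases h4 : u ≤ b <;> by_cases h5 : c < u <;>
          by_cases h6 : u ≤ d <;> simp [h1, h2, h3, h4, h5, h6]
      · simp [h1]
  rw [← integral_indicator measurableSet_Icc]
  simp_rw [h]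
  rw [integral_indicator measurableSet_Ioc, setIntegral_const, smul_eq_mul, mul_one,
    Real.volume_real_Ioc, NNReal.coe_sub_def]

namespace SimpleProcess

variable {Ω : Type*} {mΩ : MeasurableSpace Ω} {𝓕 ℋ : Filtration ℝ≥0 mΩ} {μ : Measure Ω}
  {T : ℝ≥0} {B B' : ℝ≥0 → Ω → ℝ} {ρ : ℝ}

lemma measurable_coeff (φ : SimpleProcess 𝓕) (i : ℕ) : Measurable (φ.ξ i) :=
  (φ.measurable i).mono (𝓕.le _) le_rfl

lemma memLp_integral (φ : SimpleProcess 𝓕) (hB : ∀ u, MemLp (B u) 2 μ) (t : ℝ≥0) :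
    MemLp (φ.integral B t) 2 μ :=
  memLp_finsetSum _ fun i _ ↦
    ((hB _).sub (hB _)).bounded_mul (φ.measurable_coeff i) (φ.bounded i)

lemma uncurry_eval (φ : SimpleProcess 𝓕) (p : Ω × ℝ) :
    jointFun φ.eval p = ∑ i ∈ Finset.range φ.n, φ.ξ i p.1 *
      (Set.Ioc (φ.τ i) (φ.τ (i + 1))).indicator (fun _ ↦ (1 : ℝ)) p.2.toNNReal := by
  simp only [jointFun, eval]
  refine Finset.sum_congr rfl fun i _ ↦ ?_
  simp [Set.indicator_apply]

lemma measurable_indicator_toNNReal (a b : ℝ≥0) :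
    Measurable (fun u : ℝ ↦ (Set.Ioc a b).indicator (fun _ ↦ (1 : ℝ)) u.toNNReal) :=
  (measurable_const.indicator measurableSet_Ioc).comp measurable_real_toNNReal

lemma measurable_uncurry_eval (φ : SimpleProcess 𝓕) : Measurable (jointFun φ.eval) := by
  have : jointFun φ.eval = fun p ↦ ∑ i ∈ Finset.range φ.n, φ.ξ i p.1 *
      (Set.Ioc (φ.τ i) (φ.τ (i + 1))).indicator (fun _ ↦ (1 : ℝ)) p.2.toNNReal :=
    funext φ.uncurry_eval
  rw [this]
  exact Finset.measurable_fun_sum _ fun i _ ↦ ((φ.measurable_coeff i).comp measurable_fst).mul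
    ((measurable_indicator_toNNReal _ _).comp measurable_snd)

lemma bounded_uncurry_eval (φ : SimpleProcess 𝓕) :
    ∃ C : ℝ, ∀ p, |jointFun φ.eval p| ≤ C := by
  choose C hC using φ.bounded
  refine ⟨∑ i ∈ Finset.range φ.n, C i, fun p ↦ ?_⟩
  rw [φ.uncurry_eval]
  refine (Finset.abs_sum_le_sum_abs _ _).trans (Finset.sum_le_sum fun i _ ↦ ?_)
  rw [Set.indicator_apply]
  split_ifs
  · simpa using hC i p.1
  · simpa using (abs_nonneg _).trans (hC i p.1)

lemma memLp_uncurry_eval [IsFiniteMeasure μ] (φ : SimpleProcess 𝓕) (t : ℝ≥0) :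
    MemLp (jointFun φ.eval) 2 (timeProd μ t) := by
  obtain ⟨C, hC⟩ := φ.bounded_uncurry_eval
  exact MemLp.of_bound φ.measurable_uncurry_eval.aestronglyMeasurable C (ae_of_all _ hC)

lemma measurable_coeff_of_le (φ : SimpleProcess 𝓕) (hle : 𝓕 ≤ ℋ) {i : ℕ} {a : ℝ≥0}
    (ha : φ.τ i ≤ a) : Measurable[ℋ a] (φ.ξ i) :=
  (φ.measurable i).mono ((hle _).trans (ℋ.mono ha)) le_rfl

lemma min_le_of_min_lt_min {t a b : ℝ≥0} (h : min t a < min t b) : a ≤ min t a := by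
  rcases le_total a t with h' | h'
  · rw [min_eq_right h']
  · exact absurd (h.trans_le (min_le_left _ _)) (by rw [min_eq_left h']; exact lt_irrefl _)

/-- The covariance of two elementary integrals is `ρ` times the inner product of the integrands. -/
lemma integral_mul_integral [IsFiniteMeasure μ] (h : BracketPair ℋ μ T B B' ρ) (hle : 𝓕 ≤ ℋ)
    (φ ψ : SimpleProcess 𝓕) {t : ℝ≥0} (ht : t ≤ T) :
    ∫ ω, φ.integral B t ω * ψ.integral B' t ω ∂μ =
      ρ * ∫ p, jointFun φ.eval p * jointFun ψ.eval p ∂(timeProd μ t) := by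
  simp_rw [uncurry_eval, integral, Finset.sum_mul_sum]
  have i₁ : ∀ i j, Integrable (fun ω ↦
      φ.ξ i ω * (B (min t (φ.τ (i + 1))) ω - B (min t (φ.τ i)) ω) *
      (ψ.ξ j ω * (B' (min t (ψ.τ (j + 1))) ω - B' (min t (ψ.τ j)) ω))) μ := fun i j ↦
    (((h.memLp_left _).sub (h.memLp_left _)).bounded_mul (φ.measurable_coeff i)
      (φ.bounded i)).integrable_mul
    (((h.memLp_right _).sub (h.memLp_right _)).bounded_mul (ψ.measurable_coeff j) (ψ.bounded j))
  have iI : ∀ a b : ℝ≥0, MemLp (fun u : ℝ ↦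
      (Set.Ioc a b).indicator (fun _ ↦ (1 : ℝ)) u.toNNReal) 2
      (volume.restrict (Set.Icc (0 : ℝ) t)) := fun a b ↦
    MemLp.of_bound (measurable_indicator_toNNReal a b).aestronglyMeasurable 1
      (ae_of_all _ fun u ↦ by rw [Set.indicator_apply]; split_ifs <;> simp)
  have iξ : ∀ (χ : SimpleProcess 𝓕) i, MemLp (χ.ξ i) 2 μ := fun χ i ↦ by
    obtain ⟨C, hC⟩ := χ.bounded i
    exact MemLp.of_bound (χ.measurable_coeff i).aestronglyMeasurable C (ae_of_all _ hC)
  have e : ∀ (i j : ℕ) (p : Ω × ℝ),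
      φ.ξ i p.1 * (Set.Ioc (φ.τ i) (φ.τ (i + 1))).indicator (fun _ ↦ (1 : ℝ)) p.2.toNNReal *
      (ψ.ξ j p.1 * (Set.Ioc (ψ.τ j) (ψ.τ (j + 1))).indicator (fun _ ↦ (1 : ℝ)) p.2.toNNReal) =
      (φ.ξ i p.1 * ψ.ξ j p.1) *
      ((Set.Ioc (φ.τ i) (φ.τ (i + 1))).indicator (fun _ ↦ (1 : ℝ)) p.2.toNNReal *
      (Set.Ioc (ψ.τ j) (ψ.τ (j + 1))).indicator (fun _ ↦ (1 : ℝ)) p.2.toNNReal) :=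
    fun i j p ↦ by ring
  simp_rw [e]
  have i₂ : ∀ i j, Integrable (fun p : Ω × ℝ ↦ (φ.ξ i p.1 * ψ.ξ j p.1) *
      ((Set.Ioc (φ.τ i) (φ.τ (i + 1))).indicator (fun _ ↦ (1 : ℝ)) p.2.toNNReal *
      (Set.Ioc (ψ.τ j) (ψ.τ (j + 1))).indicator (fun _ ↦ (1 : ℝ)) p.2.toNNReal))
      (timeProd μ t) := fun i j ↦
    Integrable.mul_prod ((iξ φ i).integrable_mul (iξ ψ j)) ((iI _ _).integrable_mul (iI _ _))
  rw [integral_finsetSum _ fun i _ ↦ integrable_finsetSum _ fun j _ ↦ i₁ i j,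
    integral_finsetSum _ fun i _ ↦ integrable_finsetSum _ fun j _ ↦ i₂ i j, Finset.mul_sum]
  refine Finset.sum_congr rfl fun i _ ↦ ?_
  rw [integral_finsetSum _ fun j _ ↦ i₁ i j, integral_finsetSum _ fun j _ ↦ i₂ i j,
    Finset.mul_sum]
  refine Finset.sum_congr rfl fun j _ ↦ ?_
  rw [h.integral_mul_atoms (min_le_min_left _ (φ.mono i.le_succ))
    (min_le_min_left _ (ψ.mono j.le_succ)) ((min_le_left _ _).trans ht)
    ((min_le_left _ _).trans ht)
    (fun hlt ↦ φ.measurable_coeff_of_le hle (min_le_of_min_lt_min hlt)) (φ.bounded i)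
    (fun hlt ↦ ψ.measurable_coeff_of_le hle (min_le_of_min_lt_min hlt)) (ψ.bounded j)]
  have hp := integral_prod_mul (μ := μ) (ν := volume.restrict (Set.Icc (0 : ℝ) t))
    (fun ω ↦ φ.ξ i ω * ψ.ξ j ω) (fun u : ℝ ↦
      (Set.Ioc (φ.τ i) (φ.τ (i + 1))).indicator (fun _ ↦ (1 : ℝ)) u.toNNReal *
      (Set.Ioc (ψ.τ j) (ψ.τ (j + 1))).indicator (fun _ ↦ (1 : ℝ)) u.toNNReal)
  rw [hp, integral_indicator_Ioc_mul]
  ring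

/-- The Itô isometry for the difference of two simple processes. -/
lemma eLpNorm_integral_sub [IsFiniteMeasure μ] (h : BracketPair ℋ μ T B B 1) (hle : 𝓕 ≤ ℋ)
    (φ ψ : SimpleProcess 𝓕) {t : ℝ≥0} (ht : t ≤ T) :
    eLpNorm (φ.integral B t - ψ.integral B t) 2 μ =
      eLpNorm (jointFun φ.eval - jointFun ψ.eval) 2 (timeProd μ t) := by
  have hI : ∀ χ : SimpleProcess 𝓕, MemLp (χ.integral B t) 2 μ :=
    fun χ ↦ χ.memLp_integral h.memLp_left t
  have hE : ∀ χ : SimpleProcess 𝓕, MemLp (jointFun χ.eval) 2 (timeProd μ t) :=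
    fun χ ↦ χ.memLp_uncurry_eval t
  refine MemLp.eLpNorm_two_eq_of_integral_mul_self ((hI φ).sub (hI ψ)) ((hE φ).sub (hE ψ)) ?_
  have key : ∀ χ₁ χ₂ : SimpleProcess 𝓕, ∫ ω, χ₁.integral B t ω * χ₂.integral B t ω ∂μ =
      ∫ p, jointFun χ₁.eval p * jointFun χ₂.eval p ∂(timeProd μ t) := fun χ₁ χ₂ ↦ by
    rw [integral_mul_integral h hle χ₁ χ₂ ht, one_mul]
  rw [(hI φ).integral_sub_mul_self (hI ψ), (hE φ).integral_sub_mul_self (hE ψ), key, key, key, key]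

lemma integral_sub_integral (φ : SimpleProcess 𝓕) (B : ℝ≥0 → Ω → ℝ) {s t : ℝ≥0} (hst : s ≤ t)
    (ω : Ω) : φ.integral B t ω - φ.integral B s ω = ∑ i ∈ Finset.range φ.n, φ.ξ i ω *
      (B (max s (min t (φ.τ (i + 1)))) ω - B (max s (min t (φ.τ i))) ω) := by
  have key : ∀ a : ℝ≥0, B (min t a) ω - B (min s a) ω = B (max s (min t a)) ω - B s ω := by
    intro a
    rcases le_total a s with h | h
    · rw [min_eq_right h, min_eq_right (h.trans hst), max_eq_left h, sub_self, sub_self]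
    · rw [min_eq_left h, max_eq_right (le_min hst h)]
  simp only [integral]
  rw [← Finset.sum_sub_distrib]
  refine Finset.sum_congr rfl fun i _ ↦ ?_
  rw [← mul_sub]
  congr 1
  linarith [key (φ.τ (i + 1)), key (φ.τ i)]

lemma le_max_min_of_lt {s t a b : ℝ≥0} (h : max s (min t a) < max s (min t b)) :
    a ≤ max s (min t a) := by
  rcases le_total a t with h' | h'
  · rw [min_eq_right h']; exact le_max_right _ _
  · rw [min_eq_left h'] at h
    exact absurd h (not_lt.2 (max_le_max_left _ (min_le_left _ _)))

/-- When the bracket vanishes, the increment of one elementary integral after time `s` is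
orthogonal to the other integral, against every bounded weight known at time `s`. -/
lemma integral_weight_mul_increment_mul (h : BracketPair ℋ μ T B B' 0) (hle : 𝓕 ≤ ℋ)
    (φ ψ : SimpleProcess 𝓕) {s t r : ℝ≥0} (hst : s ≤ t) (ht : t ≤ T) (hr : r ≤ T) {Z : Ω → ℝ}
    (hZ : Measurable[ℋ s] Z) (hZb : ∃ C : ℝ, ∀ ω, |Z ω| ≤ C) :
    ∫ ω, Z ω * ((φ.integral B t ω - φ.integral B s ω) * ψ.integral B' r ω) ∂μ = 0 := by
  simp_rw [φ.integral_sub_integral B hst]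
  have e : ∀ ω, Z ω * ((∑ i ∈ Finset.range φ.n, φ.ξ i ω *
      (B (max s (min t (φ.τ (i + 1)))) ω - B (max s (min t (φ.τ i))) ω)) * ψ.integral B' r ω) =
      ∑ i ∈ Finset.range φ.n, ∑ j ∈ Finset.range ψ.n, ((Z ω * φ.ξ i ω) *
      (B (max s (min t (φ.τ (i + 1)))) ω - B (max s (min t (φ.τ i))) ω)) *
      (ψ.ξ j ω * (B' (min r (ψ.τ (j + 1))) ω - B' (min r (ψ.τ j)) ω)) := by
    intro ω
    rw [integral, Finset.sum_mul_sum, Finset.mul_sum]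
    refine Finset.sum_congr rfl fun i _ ↦ ?_
    rw [Finset.mul_sum]
    exact Finset.sum_congr rfl fun j _ ↦ by ring
  simp_rw [e]
  have hint : ∀ i j, Integrable (fun ω ↦ ((Z ω * φ.ξ i ω) *
      (B (max s (min t (φ.τ (i + 1)))) ω - B (max s (min t (φ.τ i))) ω)) *
      (ψ.ξ j ω * (B' (min r (ψ.τ (j + 1))) ω - B' (min r (ψ.τ j)) ω))) μ := fun i j ↦
    (((h.memLp_left _).sub (h.memLp_left _)).bounded_mul
      ((hZ.mono (ℋ.le s) le_rfl).mul (φ.measurable_coeff i))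
      (exists_abs_mul_le hZb (φ.bounded i))).integrable_mul
    (((h.memLp_right _).sub (h.memLp_right _)).bounded_mul (ψ.measurable_coeff j) (ψ.bounded j))
  rw [integral_finsetSum _ fun i _ ↦ integrable_finsetSum _ fun j _ ↦ hint i j]
  refine Finset.sum_eq_zero fun i _ ↦ ?_
  rw [integral_finsetSum _ fun j _ ↦ hint i j]
  refine Finset.sum_eq_zero fun j _ ↦ ?_
  rw [h.integral_mul_atoms (ξ := fun ω ↦ Z ω * φ.ξ i ω)
    (max_le_max_left _ (min_le_min_left _ (φ.mono i.le_succ)))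
    (min_le_min_left _ (ψ.mono j.le_succ))
    (max_le (hst.trans ht) ((min_le_left _ _).trans ht)) ((min_le_left _ _).trans hr)
    (fun hlt ↦ Measurable.mul (hZ.mono (ℋ.mono (le_max_left _ _)) le_rfl)
      (φ.measurable_coeff_of_le hle (le_max_min_of_lt hlt)))
    (exists_abs_mul_le hZb (φ.bounded i))
    (fun hlt ↦ ψ.measurable_coeff_of_le hle (min_le_of_min_lt_min hlt)) (ψ.bounded j)]
  simp

/-- For simple integrands the weighted expectation of the product of the two integrals does not
change after time `s`. -/
lemma integral_weight_mul_integral_mul_integral (h : BracketPair ℋ μ T B B' 0) (hle : 𝓕 ≤ ℋ)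
    (φ ψ : SimpleProcess 𝓕) {s t : ℝ≥0} (hst : s ≤ t) (ht : t ≤ T) {Z : Ω → ℝ}
    (hZ : Measurable[ℋ s] Z) (hZb : ∃ C : ℝ, ∀ ω, |Z ω| ≤ C) :
    ∫ ω, φ.integral B t ω * (Z ω * ψ.integral B' t ω) ∂μ =
      ∫ ω, φ.integral B s ω * (Z ω * ψ.integral B' s ω) ∂μ := by
  have hZm : Measurable Z := hZ.mono (ℋ.le s) le_rfl
  have hφ : ∀ r, MemLp (φ.integral B r) 2 μ := φ.memLp_integral h.memLp_left
  have hψ : ∀ r, MemLp (ψ.integral B' r) 2 μ := ψ.memLp_integral h.memLp_right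
  have hint : ∀ r r', Integrable (fun ω ↦ φ.integral B r ω * (Z ω * ψ.integral B' r' ω)) μ :=
    fun r r' ↦ (hφ r).integrable_mul ((hψ r').bounded_mul hZm hZb)
  have h₁ := integral_weight_mul_increment_mul h hle φ ψ hst ht ht hZ hZb
  have h₂ := integral_weight_mul_increment_mul h.symm hle ψ φ hst ht (hst.trans ht) hZ hZb
  -- replace the time `t` by `s` in one factor after the other
  have e₁ : ∫ ω, φ.integral B t ω * (Z ω * ψ.integral B' t ω) ∂μ =
      ∫ ω, φ.integral B s ω * (Z ω * ψ.integral B' t ω) ∂μ := by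
    rw [← sub_eq_zero, ← integral_sub (hint _ _) (hint _ _), ← h₁]
    congr 1; ext ω; ring
  have e₂ : ∫ ω, φ.integral B s ω * (Z ω * ψ.integral B' t ω) ∂μ =
      ∫ ω, φ.integral B s ω * (Z ω * ψ.integral B' s ω) ∂μ := by
    rw [← sub_eq_zero, ← integral_sub (hint _ _) (hint _ _), ← h₂]
    congr 1; ext ω; ring
  rw [e₁, e₂]

end SimpleProcess

/-! ### Density of simple processes -/

/-- Continuity of translations in `L²(ℝ)`. -/
lemma tendsto_lintegral_enorm_sub_translate_sq {G : ℝ → ℝ} (hG : MemLp G 2 volume) :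
    Tendsto (fun w ↦ ∫⁻ x, ‖G x - G (x + w)‖ₑ ^ 2) (𝓝 0) (𝓝 0) := by
  have hmp : ∀ w : ℝ, MeasurePreserving (fun x : ℝ ↦ x + w) volume volume :=
    fun w ↦ measurePreserving_add_right volume w
  let g : C(ℝ, C(ℝ, ℝ)) := ContinuousMap.curry ⟨fun p : ℝ × ℝ ↦ p.2 + p.1, by fun_prop⟩
  have hlim := Filter.Tendsto.compMeasurePreservingLp (l := 𝓝 (0 : ℝ)) (g := fun w ↦ g w)
    (g₀ := g 0) (f := fun _ ↦ hG.toLp G) (f₀ := hG.toLp G) tendsto_const_nhds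
    (g.continuous.tendsto 0) hmp (hmp 0) ENNReal.ofNat_ne_top
  have hL : ∀ w : ℝ, MemLp (fun x ↦ G (x + w)) 2 volume := fun w ↦
    hG.comp_measurePreserving (hmp w)
  have hlim' : Tendsto (fun w ↦ (hL w).toLp _) (𝓝 0) (𝓝 ((hL 0).toLp _)) := hlim
  rw [Lp.tendsto_Lp_iff_tendsto_eLpNorm''] at hlim'
  have h2 := ENNReal.Tendsto.pow (n := 2) hlim'
  rw [zero_pow two_ne_zero] at h2
  refine h2.congr fun w ↦ ?_
  rw [eLpNorm_sub_comm, eLpNorm_two_sq]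
  simp

/-- Continuity of translations in time, for a square-integrable process on `Ω × ℝ`. -/
lemma tendsto_lintegral_lintegral_translate {Ω : Type*} {mΩ : MeasurableSpace Ω} {μ : Measure Ω}
    {F : Ω × ℝ → ℝ} (hF : Measurable F)
    (hfin : ∫⁻ ω, ∫⁻ x, ‖F (ω, x)‖ₑ ^ 2 ∂volume ∂μ < ∞) :
    Tendsto (fun w ↦ ∫⁻ ω, ∫⁻ x, ‖F (ω, x) - F (ω, x + w)‖ₑ ^ 2 ∂volume ∂μ) (𝓝 0) (𝓝 0) := by
  have hsec : ∀ ω, Measurable fun x ↦ F (ω, x) := fun ω ↦ hF.comp measurable_prodMk_left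
  have hsq : ∀ ω, eLpNorm (fun x ↦ F (ω, x)) 2 volume ^ 2 = ∫⁻ x, ‖F (ω, x)‖ₑ ^ 2 :=
    fun ω ↦ eLpNorm_two_sq _
  have hmeas : Measurable fun ω ↦ ∫⁻ x, ‖F (ω, x)‖ₑ ^ 2 :=
    Measurable.lintegral_prod_right' (f := fun p ↦ ‖F p‖ₑ ^ 2) (hF.enorm.pow_const 2)
  rw [show (0 : ℝ≥0∞) = ∫⁻ _, 0 ∂μ by simp]
  refine tendsto_lintegral_filter_of_dominated_convergence
    (fun ω ↦ 4 * ∫⁻ x, ‖F (ω, x)‖ₑ ^ 2) ?_ ?_ ?_ ?_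
  · refine Eventually.of_forall fun w ↦ ?_
    exact Measurable.lintegral_prod_right' (f := fun p : Ω × ℝ ↦ ‖F p - F (p.1, p.2 + w)‖ₑ ^ 2)
      ((hF.sub (hF.comp (measurable_fst.prodMk (measurable_snd.add_const w)))).enorm.pow_const 2)
  · refine Eventually.of_forall fun w ↦ ae_of_all _ fun ω ↦ ?_
    have hmp := measurePreserving_add_right (volume : Measure ℝ) w
    have hm := (hsec ω).aestronglyMeasurable (μ := volume)
    have h1 := eLpNorm_sub_le (p := 2) hm (hm.comp_measurePreserving hmp) one_le_two
    rw [eLpNorm_comp_measurePreserving hm hmp, ← two_mul] at h1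
    calc ∫⁻ x, ‖F (ω, x) - F (ω, x + w)‖ₑ ^ 2
        = eLpNorm ((fun x ↦ F (ω, x)) - (fun x ↦ F (ω, x)) ∘ fun x ↦ x + w) 2 volume ^ 2 := by
          rw [eLpNorm_two_sq]; rfl
      _ ≤ (2 * eLpNorm (fun x ↦ F (ω, x)) 2 volume) ^ 2 := by gcongr
      _ = 4 * ∫⁻ x, ‖F (ω, x)‖ₑ ^ 2 := by rw [mul_pow, hsq]; norm_num
  · rw [lintegral_const_mul _ hmeas]
    exact ENNReal.mul_ne_top (by simp) hfin.ne
  · filter_upwards [ae_lt_top hmeas hfin.ne] with ω hω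
    refine tendsto_lintegral_enorm_sub_translate_sq ⟨(hsec ω).aestronglyMeasurable, ?_⟩
    rw [← hsq] at hω
    by_contra htop
    rw [not_lt, top_le_iff] at htop
    simp [htop] at hω

/-- Averaging over the offset `r` of the grid `r + δ ℕ`: some offset does as well as the mean. -/
lemma exists_grid_offset {e : ℝ → ℝ → ℝ≥0∞} (he : Measurable (Function.uncurry e)) {δ : ℝ}
    (hδ : 0 < δ) {ε : ℝ≥0∞} (hε : ∀ w ∈ Set.Ioc 0 δ, ∫⁻ x, e x w ≤ ε) (K : ℕ) :
    ∃ r ∈ Set.Ioc 0 δ,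
      ∑ j ∈ Finset.range K, ∫⁻ w in Set.Ioc 0 δ, e (r + j * δ) w ≤ ε := by
  have hvol : volume (Set.Ioc 0 δ) = ENNReal.ofReal δ := by simp
  have hδ0 : ENNReal.ofReal δ ≠ 0 := by simpa using hδ
  have hshift : ∀ j : ℕ, Measurable fun p : ℝ × ℝ ↦ e (p.1 + j * δ) p.2 := fun j ↦
    he.comp ((measurable_fst.add_const _).prodMk measurable_snd)
  have hmeas : ∀ j : ℕ, Measurable fun r ↦ ∫⁻ w in Set.Ioc 0 δ, e (r + j * δ) w := fun j ↦
    Measurable.lintegral_prod_right' (hshift j)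
  obtain ⟨r, hr, hle⟩ := exists_le_setLAverage (μ := volume) (s := Set.Ioc 0 δ)
    (f := fun r ↦ ∑ j ∈ Finset.range K, ∫⁻ w in Set.Ioc 0 δ, e (r + j * δ) w)
    (by rw [hvol]; exact hδ0) (by rw [hvol]; exact ENNReal.ofReal_ne_top)
    (Finset.measurable_fun_sum _ fun j _ ↦ hmeas j).aemeasurable
  refine ⟨r, hr, hle.trans ?_⟩
  rw [setLAverage_eq, hvol]
  refine ENNReal.div_le_of_le_mul ?_
  rw [lintegral_finsetSum _ fun j _ ↦ hmeas j]
  have hswap : ∀ j : ℕ, ∫⁻ r in Set.Ioc 0 δ, ∫⁻ w in Set.Ioc 0 δ, e (r + j * δ) w =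
      ∫⁻ w in Set.Ioc 0 δ, ∫⁻ r in Set.Ioc 0 δ, e (r + j * δ) w := fun j ↦
    lintegral_lintegral_swap (hshift j).aemeasurable
  simp_rw [hswap]
  have hmeas' : ∀ j : ℕ, Measurable fun w ↦ ∫⁻ r in Set.Ioc 0 δ, e (r + j * δ) w := fun j ↦
    Measurable.lintegral_prod_left' (hshift j)
  rw [← lintegral_finsetSum _ fun j _ ↦ hmeas' j]
  have hinner : ∀ w ∈ Set.Ioc 0 δ,
      ∑ j ∈ Finset.range K, ∫⁻ r in Set.Ioc 0 δ, e (r + j * δ) w ≤ ε := by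
    intro w hw
    refine le_trans ?_ (hε w hw)
    have htr : ∀ j : ℕ, ∫⁻ r in Set.Ioc 0 δ, e (r + j * δ) w =
        ∫⁻ x in Set.Ioc ((j : ℝ) * δ) ((j + 1 : ℕ) * δ), e x w := by
      intro j
      rw [← (measurePreserving_add_right volume ((j : ℝ) * δ)).setLIntegral_comp_preimage_emb
        (measurableEmbedding_addRight _) (fun x ↦ e x w)]
      congr 2
      ext x
      simp only [Set.mem_Ioc, Set.mem_preimage, Nat.cast_add, Nat.cast_one, add_mul, one_mul]
      constructor <;> rintro ⟨h1, h2⟩ <;> constructor <;> linarith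
    simp_rw [htr]
    have hmono : Monotone fun j : ℕ ↦ (j : ℝ) * δ := fun i j hij ↦ by
      have : (i : ℝ) ≤ j := by exact_mod_cast hij
      exact mul_le_mul_of_nonneg_right this hδ.le
    have hdisj := hmono.pairwise_disjoint_on_Ioc_succ
    rw [← lintegral_biUnion_finset (s := Finset.range K)
      (t := fun j : ℕ ↦ Set.Ioc ((j : ℝ) * δ) ((j + 1 : ℕ) * δ))
      (fun i _ j _ hij ↦ hdisj hij) (fun _ _ ↦ measurableSet_Ioc)]
    exact setLIntegral_le_lintegral _ _
  calc ∫⁻ w in Set.Ioc 0 δ, ∑ j ∈ Finset.range K, ∫⁻ r in Set.Ioc 0 δ, e (r + j * δ) w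
      ≤ ∫⁻ _ in Set.Ioc 0 δ, ε := setLIntegral_mono measurable_const hinner
    _ = ε * ENNReal.ofReal δ := by rw [setLIntegral_const, hvol]

namespace SimpleProcess

variable {Ω : Type*} {mΩ : MeasurableSpace Ω} {𝓕 : Filtration ℝ≥0 mΩ}

lemma eval_of_mem (φ : SimpleProcess 𝓕) {i : ℕ} (hi : i < φ.n) {u : ℝ≥0}
    (hu : u ∈ Set.Ioc (φ.τ i) (φ.τ (i + 1))) (ω : Ω) : φ.eval u ω = φ.ξ i ω := by
  rw [eval, Finset.sum_eq_single_of_mem i (Finset.mem_range.2 hi), Set.indicator_of_mem hu]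
  intro j _ hji
  refine Set.indicator_of_notMem (fun hj ↦ ?_) _
  exact Set.disjoint_left.1 (φ.mono.pairwise_disjoint_on_Ioc_succ hji) hj hu

lemma eval_of_le (φ : SimpleProcess 𝓕) {u : ℝ≥0} (hu : u ≤ φ.τ 0) (ω : Ω) : φ.eval u ω = 0 :=
  Finset.sum_eq_zero fun i _ ↦
    Set.indicator_of_notMem (fun hi ↦ (hu.trans (φ.mono i.zero_le)).not_gt hi.1) _

end SimpleProcess

section Density

variable {Ω : Type*} {mΩ : MeasurableSpace Ω} {μ : Measure Ω} {𝓕 : Filtration ℝ≥0 mΩ} {T : ℝ≥0}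

/-- The simple process equal to `F (·, r + j δ)` on `(r + j δ, r + (j + 1) δ]` for `j < K`, where
`F` is bounded and adapted. Sampling at left end points keeps it adapted, without any progressive
measurability of `F`. -/
def gridSample {F : Ω × ℝ → ℝ} {N : ℝ} (hN : ∀ p, |F p| ≤ N)
    (hF : ∀ u : ℝ≥0, Measurable[𝓕 u] fun ω ↦ F (ω, u)) (r δ : ℝ≥0) (K : ℕ) :
    SimpleProcess 𝓕 where
  n := K
  τ j := r + j * δ
  ξ j ω := F (ω, (r + j * δ : ℝ≥0))
  mono i j hij := by
    have : (i : ℝ≥0) ≤ j := by exact_mod_cast hij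
    exact add_le_add_right (mul_le_mul_left this δ) r
  measurable j := hF _
  bounded j := ⟨N, fun ω ↦ hN _⟩

lemma Icc_subset_grid {r δ t : ℝ} {K : ℕ} (hK : t ≤ r + K * δ) :
    Set.Icc 0 t ⊆ Set.Icc 0 r ∪
      ⋃ j ∈ Finset.range K, Set.Ioc (r + j * δ) (r + (j + 1 : ℕ) * δ) := by
  induction K generalizing t with
  | zero => exact fun u hu ↦ Or.inl ⟨hu.1, hu.2.trans (by simpa using hK)⟩
  | succ K ih =>
    intro u hu
    rcases le_or_gt u (r + K * δ) with h | h
    · rcases ih h ⟨hu.1, le_rfl⟩ with h' | h'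
      · exact Or.inl h'
      · refine Or.inr (Set.biUnion_subset_biUnion_left (fun j hj ↦ ?_) h')
        exact Finset.mem_range.2 ((Finset.mem_range.1 hj).trans K.lt_succ_self)
    · exact Or.inr (Set.mem_biUnion (Finset.mem_coe.2 (Finset.self_mem_range_succ K))
        ⟨h, hu.2.trans hK⟩)

lemma lintegral_biUnion_finset_le {α ι : Type*} {mα : MeasurableSpace α} {ν : Measure α}
    (s : Finset ι) (A : ι → Set α) (c : α → ℝ≥0∞) :
    ∫⁻ x in ⋃ i ∈ s, A i, c x ∂ν ≤ ∑ i ∈ s, ∫⁻ x in A i, c x ∂ν := by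
  classical
  induction s using Finset.induction_on with
  | empty => simp
  | insert a s ha ih =>
    rw [Finset.set_biUnion_insert, Finset.sum_insert ha]
    exact (lintegral_union_le _ _ _).trans (by gcongr)

/-- The error of sampling at the left end points of the grid. The sample vanishes on `[0, r]`, which
costs at most `N² δ`. -/
lemma lintegral_gridSample_sub_le {F : Ω × ℝ → ℝ} {N : ℝ} (hN : ∀ p, |F p| ≤ N)
    (hF : ∀ u : ℝ≥0, Measurable[𝓕 u] fun ω ↦ F (ω, u)) {r δ : ℝ≥0} (hrδ : r ≤ δ) {K : ℕ}
    (hK : T ≤ K * δ) (ω : Ω) :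
    ∫⁻ u in Set.Icc (0 : ℝ) T, ‖(gridSample hN hF r δ K).eval u.toNNReal ω - F (ω, u)‖ₑ ^ 2 ≤
      ENNReal.ofReal N ^ 2 * δ +
      ∑ j ∈ Finset.range K, ∫⁻ w in Set.Ioc (0 : ℝ) δ,
        ‖F (ω, (r : ℝ) + j * δ) - F (ω, ((r : ℝ) + j * δ) + w)‖ₑ ^ 2 := by
  set φ := gridSample hN hF r δ K with hφ
  have hK' : (T : ℝ) ≤ r + K * δ := by
    have : (T : ℝ) ≤ K * δ := by exact_mod_cast hK
    linarith [r.coe_nonneg]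
  refine (lintegral_mono_set (Icc_subset_grid hK')).trans ((lintegral_union_le _ _ _).trans ?_)
  refine add_le_add ?_ ((lintegral_biUnion_finset_le _ _ _).trans
    (Finset.sum_le_sum fun j hj ↦ ?_))
  · calc ∫⁻ u in Set.Icc (0 : ℝ) r, ‖φ.eval u.toNNReal ω - F (ω, u)‖ₑ ^ 2
        ≤ ∫⁻ _ in Set.Icc (0 : ℝ) r, ENNReal.ofReal N ^ 2 := by
          refine setLIntegral_mono measurable_const fun u hu ↦ ?_
          rw [φ.eval_of_le (by simpa [hφ, gridSample, Real.toNNReal_le_iff_le_coe] using hu.2),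
            zero_sub, enorm_neg,
            Real.enorm_eq_ofReal_abs]
          gcongr
          exact hN _
      _ ≤ ENNReal.ofReal N ^ 2 * δ := by
          rw [setLIntegral_const, Real.volume_Icc, sub_zero, ENNReal.ofReal_coe_nnreal]
          gcongr
  · have hj' := Finset.mem_range.1 hj
    rw [← (measurePreserving_add_left volume ((r : ℝ) + j * δ)).setLIntegral_comp_preimage_emb
      (measurableEmbedding_addLeft _)]
    have hpre : (fun w : ℝ ↦ (r : ℝ) + j * δ + w) ⁻¹'
        Set.Ioc ((r : ℝ) + j * δ) (r + (j + 1 : ℕ) * δ) = Set.Ioc 0 (δ : ℝ) := by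
      ext x
      simp only [Set.mem_Ioc, Set.mem_preimage, Nat.cast_add, Nat.cast_one, add_mul, one_mul]
      constructor <;> rintro ⟨h1, h2⟩ <;> constructor <;> linarith
    rw [hpre]
    refine le_of_eq (setLIntegral_congr_fun measurableSet_Ioc fun w hw ↦ ?_)
    lift w to ℝ≥0 using hw.1.le
    have hw1 : 0 < w := by exact_mod_cast hw.1
    have hw2 : w ≤ δ := by exact_mod_cast hw.2
    have hnn : ((r : ℝ) + j * δ + w).toNNReal = r + j * δ + w := by
      rw [← NNReal.coe_inj, Real.coe_toNNReal _ (by positivity)]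
      push_cast; rfl
    rw [hnn, φ.eval_of_mem (i := j) hj']
    · simp [hφ, gridSample]
    · simp only [hφ, gridSample, Set.mem_Ioc]
      refine ⟨lt_add_of_pos_right _ hw1, ?_⟩
      rw [Nat.cast_add, Nat.cast_one, add_mul, one_mul, ← add_assoc]
      gcongr

/-- Simple processes approximate bounded, jointly measurable, adapted processes. -/
lemma exists_simpleProcess_lintegral_le [IsProbabilityMeasure μ] {F : Ω × ℝ → ℝ}
    (hFm : Measurable F) {N : ℝ} (hN : ∀ p, |F p| ≤ N)
    (hF : ∀ u : ℝ≥0, Measurable[𝓕 u] fun ω ↦ F (ω, u))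
    (hfin : ∫⁻ ω, ∫⁻ x, ‖F (ω, x)‖ₑ ^ 2 ∂volume ∂μ < ∞) {ε : ℝ≥0∞} (hε : 0 < ε) :
    ∃ φ : SimpleProcess 𝓕, ∫⁻ ω, ∫⁻ u in Set.Icc (0 : ℝ) T,
      ‖φ.eval u.toNNReal ω - F (ω, u)‖ₑ ^ 2 ∂volume ∂μ ≤ ε := by
  have hε2 : 0 < ε / 2 := ENNReal.half_pos hε.ne'
  have h1 := (tendsto_lintegral_lintegral_translate hFm hfin).eventually_le_const hε2
  have h2 : ∀ᶠ δ : ℝ in 𝓝 0, ENNReal.ofReal N ^ 2 * ENNReal.ofReal δ ≤ ε / 2 := by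
    have : Tendsto (fun δ : ℝ ↦ ENNReal.ofReal N ^ 2 * ENNReal.ofReal δ) (𝓝 0)
        (𝓝 (ENNReal.ofReal N ^ 2 * ENNReal.ofReal 0)) :=
      ENNReal.Tendsto.const_mul (ENNReal.tendsto_ofReal tendsto_id)
        (Or.inr (ENNReal.pow_ne_top ENNReal.ofReal_ne_top))
    rw [ENNReal.ofReal_zero, mul_zero] at this
    exact this.eventually_le_const hε2
  obtain ⟨η, hη, hball⟩ := Metric.eventually_nhds_iff.1 (h1.and h2)
  obtain ⟨δ, hδdef⟩ : ∃ δ : ℝ≥0, (δ : ℝ) = η / 2 := ⟨⟨η / 2, by positivity⟩, rfl⟩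
  have hδpos : (0 : ℝ) < δ := by rw [hδdef]; positivity
  have hδη : (δ : ℝ) < η := by rw [hδdef]; linarith
  obtain ⟨K, hK⟩ := exists_nat_ge ((T : ℝ) / δ)
  have hK' : T ≤ K * δ := by
    rw [div_le_iff₀ hδpos] at hK
    exact_mod_cast hK
  have hGm : Measurable fun q : (ℝ × ℝ) × Ω ↦ ‖F (q.2, q.1.1) - F (q.2, q.1.1 + q.1.2)‖ₑ ^ 2 := by
    refine Measurable.pow_const (Measurable.enorm (Measurable.sub (hFm.comp ?_) (hFm.comp ?_))) 2
    · fun_prop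
    · fun_prop
  have hem : Measurable (Function.uncurry fun x w : ℝ ↦
      ∫⁻ ω, ‖F (ω, x) - F (ω, x + w)‖ₑ ^ 2 ∂μ) := Measurable.lintegral_prod_right' hGm
  obtain ⟨r, hr, hle⟩ := exists_grid_offset hem hδpos (ε := ε / 2) (fun w hw ↦ by
    have hw' : dist w 0 < η := by
      rw [Real.dist_0_eq_abs, abs_of_pos hw.1]
      exact hw.2.trans_lt hδη
    refine le_trans (le_of_eq ?_) (hball hw').1
    refine (lintegral_lintegral_swap (f := fun ω x ↦ ‖F (ω, x) - F (ω, x + w)‖ₑ ^ 2) ?_).symm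
    refine Measurable.aemeasurable ?_
    exact hGm.comp (g := fun q ↦ ‖F (q.2, q.1.1) - F (q.2, q.1.1 + q.1.2)‖ₑ ^ 2)
      (f := fun p : Ω × ℝ ↦ ((p.2, w), p.1)) (by fun_prop)) K
  lift r to ℝ≥0 using hr.1.le
  refine ⟨gridSample hN hF r δ K, ?_⟩
  refine (lintegral_mono fun ω ↦ lintegral_gridSample_sub_le hN hF
    (by exact_mod_cast hr.2) hK' ω).trans ?_
  rw [lintegral_add_left measurable_const, lintegral_const, measure_univ, mul_one]
  have hjm : ∀ j : ℕ, Measurable fun p : Ω × ℝ ↦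
      ‖F (p.1, (r : ℝ) + j * δ) - F (p.1, ((r : ℝ) + j * δ) + p.2)‖ₑ ^ 2 := fun j ↦
    hGm.comp (g := fun q ↦ ‖F (q.2, q.1.1) - F (q.2, q.1.1 + q.1.2)‖ₑ ^ 2)
      (f := fun p : Ω × ℝ ↦ (((r : ℝ) + j * δ, p.2), p.1)) (by fun_prop)
  rw [lintegral_finsetSum _ fun j _ ↦ Measurable.lintegral_prod_right' (hjm j)]
  have hsw : ∀ j : ℕ, ∫⁻ ω, ∫⁻ w in Set.Ioc (0 : ℝ) δ,
      ‖F (ω, (r : ℝ) + j * δ) - F (ω, ((r : ℝ) + j * δ) + w)‖ₑ ^ 2 ∂volume ∂μ =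
      ∫⁻ w in Set.Ioc (0 : ℝ) δ, ∫⁻ ω,
        ‖F (ω, (r : ℝ) + j * δ) - F (ω, ((r : ℝ) + j * δ) + w)‖ₑ ^ 2 ∂μ := fun j ↦
    lintegral_lintegral_swap (hjm j).aemeasurable
  simp_rw [hsw]
  calc _ ≤ ε / 2 + ε / 2 := by
        refine add_le_add ?_ hle
        have := (hball (y := (δ : ℝ)) (by
          rw [Real.dist_0_eq_abs, abs_of_pos hδpos]; exact hδη)).2
        rwa [ENNReal.ofReal_coe_nnreal] at this
    _ = ε := ENNReal.add_halves ε

/-- Simple processes are dense among the jointly measurable adapted processes which are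
square-integrable on `Ω × [0, T]`. -/
theorem exists_tendsto_eLpNorm_simpleProcess [IsProbabilityMeasure μ] {f : ℝ≥0 → Ω → ℝ}
    (hf_meas : Measurable (fun p : Set.Iic T × Ω ↦ f p.1 p.2))
    (hf_adapted : ∀ u ≤ T, Measurable[𝓕 u] (f u))
    (hf : ∫⁻ ω, ∫⁻ u in Set.Icc (0 : ℝ) T, ‖f u.toNNReal ω‖ₑ ^ 2 ∂volume ∂μ < ∞) :
    AEStronglyMeasurable (jointFun f) (timeProd μ T) ∧
    ∃ φ : ℕ → SimpleProcess 𝓕, Tendsto (fun k ↦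
      eLpNorm (jointFun (φ k).eval - jointFun f) 2 (timeProd μ T)) atTop (𝓝 0) := by
  -- the process, set to zero off `[0, T]`, where nothing is known about `f`
  set F : Ω × ℝ → ℝ := {p : Ω × ℝ | p.2 ∈ Set.Icc (0 : ℝ) T}.indicator
    (fun p ↦ f (min p.2.toNNReal T) p.1) with hFdef
  have hset : MeasurableSet {p : Ω × ℝ | p.2 ∈ Set.Icc (0 : ℝ) T} :=
    measurable_snd measurableSet_Icc
  have hFm : Measurable F := by
    refine Measurable.indicator ?_ hset
    exact hf_meas.comp (f := fun p : Ω × ℝ ↦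
      ((⟨min p.2.toNNReal T, Set.mem_Iic.2 (min_le_right _ _)⟩ :
      Set.Iic T), p.1)) (Measurable.prodMk (Measurable.subtype_mk (by fun_prop)) measurable_fst)
  have hFf : ∀ p : Ω × ℝ, p.2 ∈ Set.Icc (0 : ℝ) T → F p = jointFun f p := by
    intro p hp
    rw [hFdef, Set.indicator_of_mem (by exact hp), min_eq_left (Real.toNNReal_le_iff_le_coe.2 hp.2)]
    rfl
  have hF0 : ∀ ω u, u ∉ Set.Icc (0 : ℝ) T → F (ω, u) = 0 := fun ω u hu ↦
    Set.indicator_of_notMem (by exact hu) _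
  have hae : F =ᵐ[timeProd μ T] jointFun f := by
    have hae' : ∀ᵐ p ∂(timeProd μ T), p.2 ∈ Set.Icc (0 : ℝ) T :=
      Measure.quasiMeasurePreserving_snd.ae (ae_restrict_mem measurableSet_Icc)
    filter_upwards [hae'] with p hp using hFf p hp
  have hFad : ∀ u : ℝ≥0, Measurable[𝓕 u] fun ω ↦ F (ω, u) := by
    intro u
    by_cases hu : u ≤ T
    · have : (fun ω ↦ F (ω, u)) = f u := by
        ext ω
        rw [hFf (ω, u) ⟨u.coe_nonneg, NNReal.coe_le_coe.2 hu⟩]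
        simp [jointFun]
      rw [this]
      exact hf_adapted u hu
    · have : (fun ω ↦ F (ω, u)) = fun _ ↦ 0 := by
        ext ω
        exact hF0 _ _ fun h ↦ hu (NNReal.coe_le_coe.1 h.2)
      rw [this]
      exact measurable_const
  have hfinQ : ∫⁻ p, ‖F p‖ₑ ^ 2 ∂(timeProd μ T) ≠ ∞ := by
    rw [lintegral_prod _ (hFm.enorm.pow_const 2).aemeasurable]
    refine ne_of_lt (lt_of_eq_of_lt (lintegral_congr fun ω ↦ ?_) hf)
    refine setLIntegral_congr_fun measurableSet_Icc fun u hu ↦ ?_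
    rw [hFf (ω, u) hu]
    rfl
  refine ⟨hFm.aestronglyMeasurable.congr hae, ?_⟩
  -- truncation of the values at level `k`
  set G : ℕ → Ω × ℝ → ℝ := fun k ↦ {p | |F p| ≤ k}.indicator F with hGdef
  have hGm : ∀ k, Measurable (G k) := fun k ↦
    hFm.indicator (measurableSet_le (measurable_abs.comp hFm) measurable_const)
  have hGb : ∀ k p, |G k p| ≤ k := by
    intro k p
    simp only [hGdef, Set.indicator_apply, Set.mem_ofPred_eq]
    split_ifs with h
    · exact h
    · simp
  have hGle : ∀ k p, ‖G k p‖ₑ ≤ ‖F p‖ₑ := fun k p ↦ by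
    simp only [hGdef]
    exact enorm_indicator_le_enorm_self _ _
  have hGad : ∀ k (u : ℝ≥0), Measurable[𝓕 u] fun ω ↦ G k (ω, u) := by
    intro k u
    have : (fun ω ↦ G k (ω, u)) = {ω | |F (ω, u)| ≤ k}.indicator fun ω ↦ F (ω, u) := by
      ext ω
      simp only [hGdef, Set.indicator_apply, Set.mem_ofPred_eq]
    rw [this]
    exact Measurable.indicator (hFad u)
      (measurableSet_le (measurable_abs.comp (hFad u)) measurable_const)
  have hGfin : ∀ k, ∫⁻ ω, ∫⁻ x, ‖G k (ω, x)‖ₑ ^ 2 ∂volume ∂μ < ∞ := by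
    intro k
    refine lt_of_le_of_lt (lintegral_mono fun ω ↦ ?_) hf
    rw [← lintegral_indicator measurableSet_Icc]
    refine lintegral_mono fun u ↦ ?_
    by_cases hu : u ∈ Set.Icc (0 : ℝ) T
    · rw [Set.indicator_of_mem hu]
      have := hGle k (ω, u)
      rw [hFf (ω, u) hu] at this
      exact pow_le_pow_left' this 2
    · have := hGle k (ω, u)
      rw [hF0 ω u hu, enorm_zero, nonpos_iff_eq_zero] at this
      simp [this]
  have htrunc : Tendsto (fun k ↦ eLpNorm (G k - F) 2 (timeProd μ T)) atTop (𝓝 0) := by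
    rw [← tendsto_eLpNorm_two_iff]
    simp_rw [eLpNorm_two_sq]
    rw [show (0 : ℝ≥0∞) = ∫⁻ _, 0 ∂(timeProd μ T) by simp]
    refine tendsto_lintegral_of_dominated_convergence (fun p ↦ ‖F p‖ₑ ^ 2)
      (fun k ↦ ((hGm k).sub hFm).enorm.pow_const 2) (fun k ↦ ae_of_all _ fun p ↦ ?_) hfinQ
      (ae_of_all _ fun p ↦ ?_)
    · refine pow_le_pow_left' ?_ 2
      simp only [hGdef, Pi.sub_apply, Set.indicator_apply, Set.mem_ofPred_eq]
      split_ifs <;> simp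
    · obtain ⟨n, hn⟩ := exists_nat_ge |F p|
      refine tendsto_const_nhds.congr' ?_
      filter_upwards [eventually_ge_atTop n] with k hk
      have : |F p| ≤ k := hn.trans (by exact_mod_cast hk)
      simp [hGdef, this]
  have happrox : ∀ k : ℕ, ∃ φ : SimpleProcess 𝓕,
      eLpNorm (jointFun φ.eval - G k) 2 (timeProd μ T) ≤ ((k : ℝ≥0∞) + 1)⁻¹ := by
    intro k
    obtain ⟨φ, hφ⟩ := exists_simpleProcess_lintegral_le (T := T) (hGm k) (hGb k) (hGad k)
      (hGfin k) (ε := ((k : ℝ≥0∞) + 1)⁻¹ ^ 2) (by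
        exact pos_iff_ne_zero.2 (pow_ne_zero 2 (ENNReal.inv_ne_zero.2 (by finiteness))))
    refine ⟨φ, ?_⟩
    have hm : AEStronglyMeasurable (jointFun φ.eval - G k) (timeProd μ T) :=
      (φ.measurable_uncurry_eval.sub (hGm k)).aestronglyMeasurable
    have := lintegral_lintegral_enorm_sq hm
    exact (ENNReal.pow_le_pow_left_iff two_ne_zero).1 (this.symm.trans_le hφ)
  choose φ hφ using happrox
  refine ⟨φ, ?_⟩
  have hz : Tendsto (fun k : ℕ ↦ ((k : ℝ≥0∞) + 1)⁻¹ + eLpNorm (G k - F) 2 (timeProd μ T))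
      atTop (𝓝 0) := by
    have h0 : Tendsto (fun k : ℕ ↦ ((k : ℝ≥0∞) + 1)⁻¹) atTop (𝓝 0) := by
      refine (ENNReal.tendsto_inv_nat_nhds_zero.comp (tendsto_add_atTop_nat 1)).congr fun k ↦ ?_
      simp
    simpa using h0.add htrunc
  refine tendsto_of_tendsto_of_tendsto_of_le_of_le tendsto_const_nhds hz (fun _ ↦ bot_le)
    fun k ↦ ?_
  calc eLpNorm (jointFun (φ k).eval - jointFun f) 2 (timeProd μ T)
      = eLpNorm ((jointFun (φ k).eval - G k) + (G k - F)) 2 (timeProd μ T) := by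
        refine eLpNorm_congr_ae ?_
        filter_upwards [hae] with p hp
        simp [hp]
    _ ≤ _ := eLpNorm_add_le ((φ k).measurable_uncurry_eval.sub (hGm k)).aestronglyMeasurable
        ((hGm k).sub hFm).aestronglyMeasurable one_le_two
    _ ≤ _ := by gcongr; exact hφ k

end Density

/-! ### The Itô integral as an `L²` limit -/

section Ito

variable {Ω : Type*} {mΩ : MeasurableSpace Ω} {μ : Measure Ω} {𝓕 ℋ : Filtration ℝ≥0 mΩ}
  {T : ℝ≥0} {B : ℝ≥0 → Ω → ℝ}

lemma timeProd_mono {s t : ℝ≥0} [SFinite μ] (hst : s ≤ t) : timeProd μ s ≤ timeProd μ t :=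
  Measure.prod_mono le_rfl
    (Measure.restrict_mono (Set.Icc_subset_Icc_right (NNReal.coe_le_coe.2 hst)) le_rfl)

/-- Elementary integrals form a Cauchy sequence in `L²` as soon as the integrands converge. -/
lemma exists_tendsto_integral [IsFiniteMeasure μ] (h : BracketPair ℋ μ T B B 1) (hle : 𝓕 ≤ ℋ)
    {t : ℝ≥0} (ht : t ≤ T) {F : Ω × ℝ → ℝ} (hF : AEStronglyMeasurable F (timeProd μ t))
    {φ : ℕ → SimpleProcess 𝓕} (hφ : Tendsto (fun k ↦
      eLpNorm (jointFun (φ k).eval - F) 2 (timeProd μ t)) atTop (𝓝 0)) :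
    ∃ X : Ω → ℝ, MemLp X 2 μ ∧
      Tendsto (fun k ↦ eLpNorm ((φ k).integral B t - X) 2 μ) atTop (𝓝 0) := by
  have hL : ∀ k, MemLp ((φ k).integral B t) 2 μ := fun k ↦ (φ k).memLp_integral h.memLp_left t
  have hbound : ∀ m n, eLpNorm ((φ m).integral B t - (φ n).integral B t) 2 μ ≤
      eLpNorm (jointFun (φ m).eval - F) 2 (timeProd μ t) +
      eLpNorm (jointFun (φ n).eval - F) 2 (timeProd μ t) := by
    intro m n
    rw [SimpleProcess.eLpNorm_integral_sub h hle _ _ ht]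
    have := eLpNorm_sub_le (p := 2)
      ((φ m).measurable_uncurry_eval.aestronglyMeasurable.sub hF)
      ((φ n).measurable_uncurry_eval.aestronglyMeasurable.sub hF) one_le_two
    rwa [sub_sub_sub_cancel_right] at this
  have hcauchy : CauchySeq fun k ↦ (hL k).toLp := by
    rw [Lp.cauchySeq_Lp_iff_cauchySeq_eLpNorm]
    have hsum : Tendsto (fun n : ℕ × ℕ ↦
        eLpNorm (jointFun (φ n.1).eval - F) 2 (timeProd μ t) +
        eLpNorm (jointFun (φ n.2).eval - F) 2 (timeProd μ t)) atTop (𝓝 0) := by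
      rw [← prod_atTop_atTop_eq]
      simpa using (hφ.comp tendsto_fst).add (hφ.comp tendsto_snd)
    refine tendsto_of_tendsto_of_tendsto_of_le_of_le tendsto_const_nhds hsum (fun _ ↦ bot_le)
      fun n ↦ ?_
    refine le_trans (le_of_eq (eLpNorm_congr_ae ?_)) (hbound n.1 n.2)
    exact (hL n.1).coeFn_toLp.sub (hL n.2).coeFn_toLp
  obtain ⟨X, hX⟩ := cauchySeq_tendsto_of_complete hcauchy
  refine ⟨X, Lp.memLp X, ?_⟩
  have := (Lp.tendsto_Lp_iff_tendsto_eLpNorm' _ _).1 hX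
  refine this.congr fun k ↦ eLpNorm_congr_ae ?_
  exact (hL k).coeFn_toLp.sub EventuallyEq.rfl

/-- One sequence of simple processes computes all the integrals `∫₀ᵗ f dB`, `t ≤ T`. The random
variable picked by `itoIntegral` may come from another sequence; the isometry identifies the two
limits. -/
theorem exists_tendsto_itoIntegral [IsProbabilityMeasure μ] (h : BracketPair ℋ μ T B B 1)
    (hle : 𝓕 ≤ ℋ) {f : ℝ≥0 → Ω → ℝ}
    (hf_meas : Measurable (fun p : Set.Iic T × Ω ↦ f p.1 p.2))
    (hf_adapted : ∀ u ≤ T, Measurable[𝓕 u] (f u))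
    (hf : ∫⁻ ω, ∫⁻ u in Set.Icc (0 : ℝ) T, ‖f u.toNNReal ω‖ₑ ^ 2 ∂volume ∂μ < ∞) :
    ∃ φ : ℕ → SimpleProcess 𝓕, ∀ t ≤ T, MemLp (itoIntegral 𝓕 μ B f t) 2 μ ∧
      Tendsto (fun k ↦ eLpNorm ((φ k).integral B t - itoIntegral 𝓕 μ B f t) 2 μ)
        atTop (𝓝 0) := by
  obtain ⟨hFT, φ, hφT⟩ := exists_tendsto_eLpNorm_simpleProcess hf_meas hf_adapted hf
  refine ⟨φ, fun t ht ↦ ?_⟩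
  have hF : AEStronglyMeasurable (jointFun f) (timeProd μ t) :=
    hFT.mono_measure (timeProd_mono ht)
  have hφ : Tendsto (fun k ↦ eLpNorm (jointFun (φ k).eval - jointFun f) 2
      (timeProd μ t)) atTop (𝓝 0) :=
    tendsto_of_tendsto_of_tendsto_of_le_of_le tendsto_const_nhds hφT (fun _ ↦ bot_le)
      fun _ ↦ eLpNorm_mono_measure _ (timeProd_mono ht)
  have hdist : ∀ ψ : SimpleProcess 𝓕, ∫⁻ ω, ∫⁻ u in Set.Icc (0 : ℝ) t,
      ‖ψ.eval u.toNNReal ω - f u.toNNReal ω‖ₑ ^ 2 ∂volume ∂μ =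
      eLpNorm (jointFun ψ.eval - jointFun f) 2 (timeProd μ t) ^ 2 := fun ψ ↦
    lintegral_lintegral_enorm_sq (ψ.measurable_uncurry_eval.aestronglyMeasurable.sub hF)
  have hex : ∃ X : Ω → ℝ, IsItoIntegral 𝓕 μ B f t X := by
    obtain ⟨X, hX, hlim⟩ := exists_tendsto_integral h hle ht hF hφ
    refine ⟨X, hX, φ, ?_, hlim⟩
    simp_rw [hdist]
    exact tendsto_eLpNorm_two_iff.2 hφ
  have hspec : IsItoIntegral 𝓕 μ B f t (itoIntegral 𝓕 μ B f t) := by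
    rw [itoIntegral, dif_pos hex]
    exact hex.choose_spec
  set X := itoIntegral 𝓕 μ B f t with hXdef
  obtain ⟨hX, ψ, hψ, hψX⟩ := hspec
  simp_rw [hdist] at hψ
  replace hψ := tendsto_eLpNorm_two_iff.1 hψ
  refine ⟨hX, ?_⟩
  have hsum := (hφ.add hψ).add hψX
  rw [add_zero, add_zero] at hsum
  refine tendsto_of_tendsto_of_tendsto_of_le_of_le tendsto_const_nhds hsum (fun _ ↦ bot_le)
    fun k ↦ ?_
  have hL : ∀ χ : SimpleProcess 𝓕, AEStronglyMeasurable (χ.integral B t) μ :=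
    fun χ ↦ (χ.memLp_integral h.memLp_left t).1
  calc eLpNorm ((φ k).integral B t - X) 2 μ
      ≤ eLpNorm ((φ k).integral B t - (ψ k).integral B t) 2 μ +
        eLpNorm ((ψ k).integral B t - X) 2 μ := by
        have := eLpNorm_add_le (p := 2) ((hL (φ k)).sub (hL (ψ k))) ((hL (ψ k)).sub hX.1)
          one_le_two
        rwa [sub_add_sub_cancel] at this
    _ ≤ _ := by
        refine add_le_add ?_ le_rfl
        rw [SimpleProcess.eLpNorm_integral_sub h hle _ _ ht]
        have := eLpNorm_sub_le (p := 2)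
          ((φ k).measurable_uncurry_eval.aestronglyMeasurable.sub hF)
          ((ψ k).measurable_uncurry_eval.aestronglyMeasurable.sub hF) one_le_two
        rwa [sub_sub_sub_cancel_right] at this

lemma tendsto_integral_mul_of_eLpNorm {X Y : Ω → ℝ} {Xk Yk : ℕ → Ω → ℝ} (hX : MemLp X 2 μ)
    (hY : MemLp Y 2 μ) (hXk : ∀ k, MemLp (Xk k) 2 μ) (hYk : ∀ k, MemLp (Yk k) 2 μ)
    (hXlim : Tendsto (fun k ↦ eLpNorm (Xk k - X) 2 μ) atTop (𝓝 0))
    (hYlim : Tendsto (fun k ↦ eLpNorm (Yk k - Y) 2 μ) atTop (𝓝 0)) :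
    Tendsto (fun k ↦ ∫ ω, Xk k ω * Yk k ω ∂μ) atTop (𝓝 (∫ ω, X ω * Y ω ∂μ)) := by
  have hinner : ∀ {x y : Ω → ℝ} (hx : MemLp x 2 μ) (hy : MemLp y 2 μ),
      inner ℝ (hy.toLp y) (hx.toLp x) = ∫ ω, x ω * y ω ∂μ := by
    intro x y hx hy
    rw [L2.inner_def]
    refine integral_congr_ae ?_
    filter_upwards [hx.coeFn_toLp, hy.coeFn_toLp] with ω h1 h2
    simp [h1, h2]
  have h1 := (Lp.tendsto_Lp_iff_tendsto_eLpNorm'' Xk hXk X hX).2 hXlim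
  have h2 := (Lp.tendsto_Lp_iff_tendsto_eLpNorm'' Yk hYk Y hY).2 hYlim
  have := h2.inner (𝕜 := ℝ) h1
  simpa only [hinner] using this

lemma tendsto_eLpNorm_bounded_mul {Z Y : Ω → ℝ} {Yk : ℕ → Ω → ℝ}
    (hb : ∃ C : ℝ, ∀ ω, |Z ω| ≤ C)
    (hlim : Tendsto (fun k ↦ eLpNorm (Yk k - Y) 2 μ) atTop (𝓝 0)) :
    Tendsto (fun k ↦ eLpNorm ((fun ω ↦ Z ω * Yk k ω) - fun ω ↦ Z ω * Y ω) 2 μ)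
      atTop (𝓝 0) := by
  obtain ⟨C, hC⟩ := hb
  have h0 := ENNReal.Tendsto.const_mul (a := ENNReal.ofReal C) hlim (Or.inr ENNReal.ofReal_ne_top)
  rw [mul_zero] at h0
  refine tendsto_of_tendsto_of_tendsto_of_le_of_le tendsto_const_nhds h0 (fun _ ↦ bot_le)
    fun k ↦ ?_
  refine eLpNorm_le_mul_eLpNorm_of_ae_le_mul (ae_of_all _ fun ω ↦ ?_) 2
  simp only [Pi.sub_apply, ← mul_sub, norm_mul]
  exact mul_le_mul_of_nonneg_right (hC ω) (norm_nonneg _)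

end Ito

/-- The filtration `𝓕` enlarged by the information `𝒢` from time `0` on. -/
def MeasureTheory.Filtration.enlarge {Ω : Type*} {mΩ : MeasurableSpace Ω}
    (𝓕 : Filtration ℝ≥0 mΩ) {𝒢 : MeasurableSpace Ω} (h𝒢 : 𝒢 ≤ mΩ) : Filtration ℝ≥0 mΩ where
  seq u := 𝓕 u ⊔ 𝒢
  mono' _ _ huv := sup_le_sup_right (𝓕.mono huv) 𝒢
  le' u := sup_le (𝓕.le u) h𝒢

theorem lemmaA4 {Ω : Type*} {mΩ : MeasurableSpace Ω} (μ : Measure Ω) [IsProbabilityMeasure μ]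
    (𝓕 : Filtration ℝ≥0 mΩ) (h𝓕 : UsualConditions 𝓕 μ)
    (B₁ B₂ : ℝ≥0 → Ω → ℝ)
    (hB₁ : IsFilteredBrownian 𝓕 μ B₁) (hB₂ : IsFilteredBrownian 𝓕 μ B₂)
    (hB : IndepFun (fun ω u ↦ B₁ u ω) (fun ω u ↦ B₂ u ω) μ)
    (T : ℝ≥0) (f g : ℝ≥0 → Ω → ℝ)
    (hf_meas : Measurable (fun p : Set.Iic T × Ω ↦ f p.1 p.2))
    (hg_meas : Measurable (fun p : Set.Iic T × Ω ↦ g p.1 p.2))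
    (hf_adapted : ∀ u ≤ T, Measurable[𝓕 u] (f u))
    (hg_adapted : ∀ u ≤ T, Measurable[𝓕 u] (g u))
    (hfg : ∫⁻ ω, ∫⁻ u in Set.Icc (0 : ℝ) T,
      (‖f u.toNNReal ω‖ₑ ^ 2 + ‖g u.toNNReal ω‖ₑ ^ 2) ∂volume ∂μ < ∞)
    (𝒢 : MeasurableSpace Ω) (h𝒢 : 𝒢 ≤ mΩ)
    (h𝒢₁ : ∀ u v : ℝ≥0, u ≤ v → v ≤ T →
      Indep (MeasurableSpace.comap (fun ω ↦ B₁ v ω - B₁ u ω) inferInstance) (𝓕 u ⊔ 𝒢) μ)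
    (h𝒢₂ : ∀ u v : ℝ≥0, u ≤ v → v ≤ T →
      Indep (MeasurableSpace.comap (fun ω ↦ B₂ v ω - B₂ u ω) inferInstance) (𝓕 u ⊔ 𝒢) μ)
    (s t : ℝ≥0) (hst : s ≤ t) (htT : t ≤ T)
    (h₁ h₂ : Ω → ℝ)
    (hh₁_meas : Measurable[𝒢] h₁) (hh₁_bdd : ∃ C : ℝ, ∀ ω, |h₁ ω| ≤ C)
    (hh₂_meas : Measurable[𝓕 s] h₂) (hh₂_bdd : ∃ C : ℝ, ∀ ω, |h₂ ω| ≤ C) :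
    Integrable
      (fun ω ↦ h₁ ω * h₂ ω * itoIntegral 𝓕 μ B₁ f t ω * itoIntegral 𝓕 μ B₂ g t ω) μ ∧
    Integrable
      (fun ω ↦ h₁ ω * h₂ ω * itoIntegral 𝓕 μ B₁ f s ω * itoIntegral 𝓕 μ B₂ g s ω) μ ∧
    ∫ ω, h₁ ω * h₂ ω * itoIntegral 𝓕 μ B₁ f t ω * itoIntegral 𝓕 μ B₂ g t ω ∂μ =
      ∫ ω, h₁ ω * h₂ ω * itoIntegral 𝓕 μ B₁ f s ω * itoIntegral 𝓕 μ B₂ g s ω ∂μ := by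
  let ℋ : Filtration ℝ≥0 mΩ := 𝓕.enlarge h𝒢
  have hle : 𝓕 ≤ ℋ := fun u ↦ le_sup_left
  have hP₁ : IsPreBrownianReal B₁ μ := hB₁.brownian.toIsPreBrownianReal
  have hP₂ : IsPreBrownianReal B₂ μ := hB₂.brownian.toIsPreBrownianReal
  have had₁ : Adapted ℋ B₁ := fun u ↦ (hB₁.adapted u).mono (hle u) le_rfl
  have had₂ : Adapted ℋ B₂ := fun u ↦ (hB₂.adapted u).mono (hle u) le_rfl
  have h11 : BracketPair ℋ μ T B₁ B₁ 1 := bracketPair_self hP₁ had₁ h𝒢₁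
  have h22 : BracketPair ℋ μ T B₂ B₂ 1 := bracketPair_self hP₂ had₂ h𝒢₂
  have h12 : BracketPair ℋ μ T B₁ B₂ 0 :=
    bracketPair_of_indepFun hP₁ hP₂ had₁ had₂ h𝒢₁ h𝒢₂ hB
  obtain ⟨φ, hφ⟩ := exists_tendsto_itoIntegral h11 hle hf_meas hf_adapted
    (lt_of_le_of_lt (lintegral_mono fun _ ↦ lintegral_mono fun _ ↦ le_self_add) hfg)
  obtain ⟨ψ, hψ⟩ := exists_tendsto_itoIntegral h22 hle hg_meas hg_adapted
    (lt_of_le_of_lt (lintegral_mono fun _ ↦ lintegral_mono fun _ ↦ le_add_self) hfg)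
  set Z : Ω → ℝ := fun ω ↦ h₁ ω * h₂ ω with hZdef
  have hZ : Measurable[ℋ s] Z :=
    Measurable.mul (hh₁_meas.mono le_sup_right le_rfl) (hh₂_meas.mono le_sup_left le_rfl)
  have hZm : Measurable[mΩ] Z := hZ.mono (ℋ.le s) le_rfl
  have hZb : ∃ C : ℝ, ∀ ω, |Z ω| ≤ C := exists_abs_mul_le hh₁_bdd hh₂_bdd
  have hrearr : ∀ r, (fun ω ↦ h₁ ω * h₂ ω * itoIntegral 𝓕 μ B₁ f r ω *
      itoIntegral 𝓕 μ B₂ g r ω) = fun ω ↦ itoIntegral 𝓕 μ B₁ f r ω *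
        (Z ω * itoIntegral 𝓕 μ B₂ g r ω) := fun r ↦ by
    ext ω; simp only [hZdef]; ring
  have hint : ∀ r ≤ T, Integrable (fun ω ↦ itoIntegral 𝓕 μ B₁ f r ω *
      (Z ω * itoIntegral 𝓕 μ B₂ g r ω)) μ := fun r hr ↦
    (hφ r hr).1.integrable_mul ((hψ r hr).1.bounded_mul hZm hZb)
  have hlim : ∀ r ≤ T, Tendsto (fun k ↦ ∫ ω, (φ k).integral B₁ r ω *
      (Z ω * (ψ k).integral B₂ r ω) ∂μ) atTop (𝓝 (∫ ω, itoIntegral 𝓕 μ B₁ f r ω *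
      (Z ω * itoIntegral 𝓕 μ B₂ g r ω) ∂μ)) := fun r hr ↦
    tendsto_integral_mul_of_eLpNorm (hφ r hr).1 ((hψ r hr).1.bounded_mul hZm hZb)
      (fun k ↦ (φ k).memLp_integral h12.memLp_left r)
      (fun k ↦ ((ψ k).memLp_integral h12.memLp_right r).bounded_mul hZm hZb)
      (hφ r hr).2 (tendsto_eLpNorm_bounded_mul hZb (hψ r hr).2)
  simp_rw [hrearr]
  refine ⟨hint t htT, hint s (hst.trans htT), tendsto_nhds_unique (hlim t htT) ?_⟩
  refine (hlim s (hst.trans htT)).congr fun k ↦ ?_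
  exact (SimpleProcess.integral_weight_mul_integral_mul_integral h12 hle (φ k) (ψ k) hst htT
    hZ hZb).symm
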